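/- **Setting.** Let $\mathcal M_+$ be the set of finite non-negative measures on $[-1,1]$, and $\mathrm{TV}(\mu,\nu)=\sup_A|\mu(A)-\nu(A)|$, the supremum being over the measurable subsets $A$ of $[-1,1]$. For an integer $K\ge1$ let $\mathcal D_K=\{i/2^K: i\in\mathbb Z,\ -2^K\le i<2^K\}$, $d=|\mathcal D_K|$, and for $x,y\in\mathbb R^{\mathcal D_K}$ put $$\|x\|_1=\frac1d\sum_{k}|x_k|,\qquad \|y\|_{1,*}=\max_k d\,|y_k|.$$ For $g:[-1,1]\to\mathbb R$ let $G^{(K)}=d^{-2}\,(g(kk'))_{k,k'\in\mathcal D_K}$, let $\mathcal C_K=\{G^{(K)}x: x\in\mathbb R_{\ge0}^{\mathcal D_K}\}$, and let $\mathsf C_K:\mathcal C_K\to\mathbb R$ be the (well-defined) function $\mathsf C_K(G^{(K)}x)=\frac12\,G^{(K)}x\cdot x$ for $x\in\mathbb R_{\ge0}^{\mathcal D_K}$. For $a>0$ let $$\mathcal K'_{a,K}=\{G^{(K)}x+z:\ x\in\mathbb R^{\mathcal D_K}_{\ge0},\ \|x\|_1\le a,\ \|z\|_{1,*}\le d^{-1/2}\}.$$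 For $\psi:\mathcal M_+\to\mathbb R$ define $\psi^{(K)}:\mathbb R_{\ge0}^{\mathcal D_K}\to\mathbb R$ by $\psi^{(K)}(x)=\psi\big(\frac1d\sum_k x_k\delta_k\big)$. A function $h$ on $\mathbb R_{\ge0}^{\mathcal D_K}$ *has its gradient in* a set $\mathcal K$ if, at Lebesgue-almost every point, $h$ is differentiable and $\nabla h\in\mathcal K$. Write $$\|h\|_{\mathrm{Lip},1}=\sup_{x\ne x'}\frac{|h(x)-h(x')|}{\|x-x'\|_1},\qquad \|\psi\|_{\mathrm{Lip},\mathrm{TV}}=\sup_{\mu\ne\nu}\frac{|\psi(\mu)-\psi(\nu)|}{\mathrm{TV}(\mu,\nu)}.$$ Let $\mathfrak L_{\mathrm{unif}}$ be the set of $u:[0,\infty)\times\mathbb R_{\ge0}^{\mathcal D_K}\to\mathbb R$ with $\sup_{t\ge0}\|u(t,\cdot)\|_{\mathrm{Lip},1}<\infty$ and $\sup_{t>0,\,x}|u(t,x)-u(0,x)|/t<\infty$. **Non-linearities.** For $R>0$, call $\mathsf H:\mathbb R^{\mathcal D_K}\to\mathbb R$ an *admissible extension* of $\mathsf C_K$ at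 level $R$ if it is non-decreasing for the coordinatewise order, Lipschitz continuous with respect to $\|\cdot\|_{1,*}$, and equal to $\mathsf C_K$ at every $y\in\mathcal C_K$ with $\|y\|_{1,*}\le R$. Given $m>0$, let $L=4R/m$, let $\widetilde{\mathsf C}_{K,R}:\mathcal C_K\to\mathbb R$ be $$\widetilde{\mathsf C}_{K,R}(y)=\begin{cases}\max\big(\mathsf C_K(y),\,\mathsf C_K(0)+2L(\|y\|_{1,*}-R)\big)&\text{if }\|y\|_{1,*}\le 2R,\\ \mathsf C_K(0)+2L(\|y\|_{1,*}-R)&\text{otherwise,}\end{cases}$$ and let $\mathsf H_{K,R}(y)=\inf\{\widetilde{\mathsf C}_{K,R}(w): w\in\mathcal C_K,\ w\ge y\}$ for $y\in\mathbb R^{\mathcal D_K}$. **Viscosity solutions.** A function $f:[0,\infty)\times\mathbb R_{\ge0}^{\mathcal D_K}\to\mathbb R$ is a *viscosity solution* of $\partial_tf=\mathsf H(\nabla f)$ on $\mathbb R_{>0}\times\mathbb R_{>0}^{\mathcal D_K}$ if it is continuous on $[0,\infty)\times\mathbb R^{\mathcal D_K}_{>0}$ and, for every $\phi\in C^\infty((0,\infty)\times\mathbb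 R^{\mathcal D_K}_{>0})$, one has $\partial_t\phi-\mathsf H(\nabla\phi)\le0$ at every local maximum of $f-\phi$ in $(0,\infty)\times\mathbb R^{\mathcal D_K}_{>0}$ and $\partial_t\phi-\mathsf H(\nabla\phi)\ge0$ at every local minimum of $f-\phi$ there. No condition is imposed on the boundary of the orthant. **Theorem.** Assume that * (H1) $g:[-1,1]\to\mathbb R$ is $C^1$ and $g\ge m$ for some $m>0$; * (H2) $\psi:\mathcal M_+\to\mathbb R$ is Lipschitz continuous with respect to $\mathrm{TV}$; * (H3) $a>0$ is such that $\psi^{(K)}$ has its gradient in $\mathcal K'_{a,K}$ for every $K\ge1$. Let $K\ge1$ and $R>0$. Then $\mathsf H_{K,R}$ is an admissible extension of $\mathsf C_K$ at level $R$. Moreover, for $\mathsf H=\mathsf H_{K,R}$, and more generally for every admissible extension $\mathsf H$ of $\mathsf C_K$ at level $R$, the equation $\partial_tf=\mathsf H(\nabla f)$ on $\mathbb R_{>0}\times\mathbb R_{>0}^{\mathcal D_K}$ has a unique viscosity solution $f\in\mathfrak L_{\mathrm{unif}}$ with $f(0,\cdot)=\psi^{(K)}$ on $\mathbb R_{\ge0}^{\mathcal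 D_K}$. For every $t\ge0$ the function $f(t,\cdot)$ has its gradient in $\mathcal K'_{a,K}$, and $$\sup_{t>0}\|f(t,\cdot)\|_{\mathrm{Lip},1}=\|\psi^{(K)}\|_{\mathrm{Lip},1}\le\|\psi\|_{\mathrm{Lip},\mathrm{TV}}.$$ -/

import Mathlib

open MeasureTheory Set
open scoped ENNReal NNReal Matrix

namespace ProjHJ

noncomputable section

/-! ### Normalized norms and Lipschitz semi-norms on the orthant -/

section Orthant

variable {ι : Type*} [Fintype ι]

/-- The normalized `ℓ¹` norm `(1/d) ∑ |x_k|`, where `d` is the number of coordinates. -/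
def normL1 (x : ι → ℝ) : ℝ := (1 / (Fintype.card ι : ℝ)) * ∑ k, |x k|

/-- The normalized `ℓ^{1,*}` norm `max_k d |y_k|`. -/
def normL1Star (y : ι → ℝ) : ℝ := ⨆ k, (Fintype.card ι : ℝ) * |y k|

/-- The closed orthant. -/
def orthant (ι : Type*) : Set (ι → ℝ) := {x | ∀ k, 0 ≤ x k}

/-- The open orthant. -/
def openOrthant (ι : Type*) : Set (ι → ℝ) := {x | ∀ k, 0 < x k}

/-- The Lipschitz constant, with respect to the normalized `ℓ¹` norm, of `h` restricted to the
closed orthant (`⊤` if `h` is not Lipschitz there). -/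
def lipL1 (h : (ι → ℝ) → ℝ) : ℝ≥0∞ :=
  ⨆ x ∈ orthant ι, ⨆ x' ∈ orthant ι, ⨆ _ : x ≠ x',
    ENNReal.ofReal (|h x - h x'| / normL1 (x - x'))

/-- The supremum over `t > 0` of the Lipschitz constants of `u(t,·)`. -/
def supLipL1 (u : ℝ → (ι → ℝ) → ℝ) : ℝ≥0∞ := ⨆ t ∈ Ioi (0 : ℝ), lipL1 (u t)

/-- The semi-norm `[u]₀ = sup_{t > 0, x} |u(t,x) - u(0,x)| / t`. -/
def timeGrowth (u : ℝ → (ι → ℝ) → ℝ) : ℝ≥0∞ :=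
  ⨆ t ∈ Ioi (0 : ℝ), ⨆ x ∈ orthant ι, ENNReal.ofReal (|u t x - u 0 x| / t)

/-- The space of functions on `[0,∞) × orthant` with Lipschitz initial condition that grow at
most linearly in time. Only the values on `[0,∞) × orthant` matter. -/
def MemL (u : ℝ → (ι → ℝ) → ℝ) : Prop := lipL1 (u 0) < ⊤ ∧ timeGrowth u < ⊤

/-- The functions of the previous space that are Lipschitz in space, uniformly in time. -/
def MemLUnif (u : ℝ → (ι → ℝ) → ℝ) : Prop :=
  MemL u ∧ (⨆ t ∈ Ici (0 : ℝ), lipL1 (u t)) < ⊤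

/-- The gradient, as the vector of partial derivatives. -/
def grad [DecidableEq ι] (h : (ι → ℝ) → ℝ) (x : ι → ℝ) : ι → ℝ :=
  fun k => fderiv ℝ h x (Pi.single k 1)

/-- `h` has its gradient in `𝒦`: at almost every point of the orthant, `h` is differentiable and
its gradient belongs to `𝒦`. -/
def HasGradientIn [DecidableEq ι] (h : (ι → ℝ) → ℝ) (𝒦 : Set (ι → ℝ)) : Prop :=
  ∀ᵐ x ∂(volume.restrict (orthant ι)), DifferentiableAt ℝ h x ∧ grad h x ∈ 𝒦

/-! ### Viscosity solutions of `∂ₜ f = H(∇ f)` on `(0,∞) × openOrthant` -/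

/-- Viscosity subsolution. -/
def IsViscositySubsolution [DecidableEq ι] (H : (ι → ℝ) → ℝ) (u : ℝ → (ι → ℝ) → ℝ) : Prop :=
  UpperSemicontinuousOn (fun p : ℝ × (ι → ℝ) => u p.1 p.2) (Ici 0 ×ˢ openOrthant ι) ∧
  ∀ φ : ℝ → (ι → ℝ) → ℝ,
    ContDiffOn ℝ ((⊤ : ℕ∞) : WithTop ℕ∞) (fun p : ℝ × (ι → ℝ) => φ p.1 p.2) (Ioi 0 ×ˢ openOrthant ι) →
    ∀ t ∈ Ioi (0 : ℝ), ∀ x ∈ openOrthant ι,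
      IsLocalMaxOn (fun p : ℝ × (ι → ℝ) => u p.1 p.2 - φ p.1 p.2)
        (Ioi 0 ×ˢ openOrthant ι) (t, x) →
      deriv (fun s => φ s x) t - H (grad (φ t) x) ≤ 0

/-- Viscosity supersolution. -/
def IsViscositySupersolution [DecidableEq ι] (H : (ι → ℝ) → ℝ) (v : ℝ → (ι → ℝ) → ℝ) : Prop :=
  LowerSemicontinuousOn (fun p : ℝ × (ι → ℝ) => v p.1 p.2) (Ici 0 ×ˢ openOrthant ι) ∧
  ∀ φ : ℝ → (ι → ℝ) → ℝ,
    ContDiffOn ℝ ((⊤ : ℕ∞) : WithTop ℕ∞) (fun p : ℝ × (ι → ℝ) => φ p.1 p.2) (Ioi 0 ×ˢ openOrthant ι) →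
    ∀ t ∈ Ioi (0 : ℝ), ∀ x ∈ openOrthant ι,
      IsLocalMinOn (fun p : ℝ × (ι → ℝ) => v p.1 p.2 - φ p.1 p.2)
        (Ioi 0 ×ˢ openOrthant ι) (t, x) →
      0 ≤ deriv (fun s => φ s x) t - H (grad (φ t) x)

/-- Viscosity solution; no condition is imposed at the boundary of the orthant. -/
def IsViscositySolution [DecidableEq ι] (H : (ι → ℝ) → ℝ) (f : ℝ → (ι → ℝ) → ℝ) : Prop :=
  ContinuousOn (fun p : ℝ × (ι → ℝ) => f p.1 p.2) (Ici 0 ×ˢ openOrthant ι) ∧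
  IsViscositySubsolution H f ∧ IsViscositySupersolution H f

/-! ### The cone, the non-linearity on the cone, and its extension -/

/-- The cone `{G x | x ≥ 0}`. -/
def cone (G : Matrix ι ι ℝ) : Set (ι → ℝ) := {y | ∃ x ∈ orthant ι, G *ᵥ x = y}

/-- The set `{G x | x ≥ 0, ‖x‖₁ ≤ a}`. -/
def coneBall (G : Matrix ι ι ℝ) (a : ℝ) : Set (ι → ℝ) :=
  {y | ∃ x ∈ orthant ι, normL1 x ≤ a ∧ G *ᵥ x = y}

/-- The closed neighbourhood of `𝒦` of radius `d^{-1/2}` in the normalized `ℓ^{1,*}` norm,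
that is, the sum of `𝒦` and the closed ball of that radius. -/
def enlarge (𝒦 : Set (ι → ℝ)) : Set (ι → ℝ) :=
  {y | ∃ z ∈ 𝒦, normL1Star (y - z) ≤ 1 / √(Fintype.card ι : ℝ)}

open Classical in
/-- The non-linearity on the cone, `G x ↦ (1/2) G x · x` for `x ≥ 0` (and `0` off the cone). By
`coneNonlinearity_mulVec` the choice of `x` does not matter. -/
def coneNonlinearity (G : Matrix ι ι ℝ) (y : ι → ℝ) : ℝ :=
  if h : ∃ x ∈ orthant ι, G *ᵥ x = y then (1 / 2) * (y ⬝ᵥ h.choose) else 0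

theorem coneNonlinearity_mulVec {G : Matrix ι ι ℝ} (hG : G.IsSymm) {x : ι → ℝ}
    (hx : x ∈ orthant ι) : coneNonlinearity G (G *ᵥ x) = (1 / 2) * ((G *ᵥ x) ⬝ᵥ x) := by
  have h : ∃ x' ∈ orthant ι, G *ᵥ x' = G *ᵥ x := ⟨x, hx, rfl⟩
  have key : ∀ u v : ι → ℝ, (G *ᵥ u) ⬝ᵥ v = (G *ᵥ v) ⬝ᵥ u := by
    intro u v
    rw [dotProduct_comm, Matrix.dotProduct_mulVec, ← Matrix.mulVec_transpose, hG.eq]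
  rw [coneNonlinearity, dif_pos h, key, h.choose_spec.2]

/-- The regularization of the non-linearity on the cone: with `L = 4R/m`, it equals
`max (C(y)) (C(0) + 2L(‖y‖ - R))` on the ball of radius `2R` and `C(0) + 2L(‖y‖ - R)` outside. -/
def regNonlinearity (G : Matrix ι ι ℝ) (m R : ℝ) (y : ι → ℝ) : ℝ :=
  if normL1Star y ≤ 2 * R then
    max (coneNonlinearity G y) (coneNonlinearity G 0 + 2 * (4 * R / m) * (normL1Star y - R))
  else coneNonlinearity G 0 + 2 * (4 * R / m) * (normL1Star y - R)

/-- The extended non-linearity `y ↦ inf {C̃(w) | w in the cone, w ≥ y}`. -/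
def extNonlinearity (G : Matrix ι ι ℝ) (m R : ℝ) (y : ι → ℝ) : ℝ :=
  sInf {r | ∃ w ∈ cone G, y ≤ w ∧ r = regNonlinearity G m R w}

/-- `H` is a non-decreasing function on the whole space, Lipschitz continuous in the normalized
`ℓ^{1,*}` norm, which agrees with the non-linearity on the cone at all points of the cone of norm
at most `R`. -/
def IsAdmissibleExtension (G : Matrix ι ι ℝ) (R : ℝ) (H : (ι → ℝ) → ℝ) : Prop :=
  (∀ y y', y ≤ y' → H y ≤ H y') ∧
  (∃ V : ℝ, ∀ y y', |H y - H y'| ≤ V * normL1Star (y - y')) ∧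
  ∀ y ∈ cone G, normL1Star y ≤ R → H y = coneNonlinearity G y

end Orthant

/-! ### Measures on `[-1,1]` and the dyadic projections -/

/-- Total variation distance `sup_A |μ(A) - ν(A)|` between finite non-negative measures. -/
def tv (μ ν : FiniteMeasure (Icc (-1 : ℝ) 1)) : ℝ :=
  ⨆ A : {A : Set (Icc (-1 : ℝ) 1) // MeasurableSet A}, |((μ A.1 : ℝ≥0) : ℝ) - ((ν A.1 : ℝ≥0) : ℝ)|

/-- The Lipschitz constant of `ψ` with respect to the total variation distance. -/
def lipTV (ψ : FiniteMeasure (Icc (-1 : ℝ) 1) → ℝ) : ℝ≥0∞ :=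
  ⨆ μ, ⨆ ν, ⨆ _ : μ ≠ ν, ENNReal.ofReal (|ψ μ - ψ ν| / tv μ ν)

/-- The dyadic rationals `i / 2^K` with `-2^K ≤ i < 2^K`, indexed by the integer `i`. -/
abbrev DyadicIdx (K : ℕ) : Type := {i : ℤ // i ∈ Finset.Ico (-(2 : ℤ) ^ K) ((2 : ℤ) ^ K)}

/-- The dyadic rational `i / 2^K` as a point of `[-1,1]`. -/
def dyadicPoint {K : ℕ} (i : DyadicIdx K) : Icc (-1 : ℝ) 1 :=
  ⟨(i.1 : ℝ) / 2 ^ K, by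
    have h := Finset.mem_Ico.1 i.2
    have h1 : (-(2 : ℝ) ^ K) ≤ (i.1 : ℝ) := by exact_mod_cast h.1
    have h2 : (i.1 : ℝ) ≤ (2 : ℝ) ^ K := by exact_mod_cast h.2.le
    have hp : (0 : ℝ) < 2 ^ K := by positivity
    exact ⟨by rw [le_div_iff₀ hp]; linarith, by rw [div_le_iff₀ hp]; linarith⟩⟩

/-- The unit mass at a point. -/
def diracFM (p : Icc (-1 : ℝ) 1) : FiniteMeasure (Icc (-1 : ℝ) 1) :=
  ⟨Measure.dirac p, inferInstance⟩

/-- The discrete measure `(1/|D_K|) ∑ x_k δ_k`, for `x` in the closed orthant. -/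
def dyadicMeasure {K : ℕ} (x : DyadicIdx K → ℝ) : FiniteMeasure (Icc (-1 : ℝ) 1) :=
  (Fintype.card (DyadicIdx K) : ℝ≥0)⁻¹ • ∑ k, (x k).toNNReal • diracFM (dyadicPoint k)

/-- The projected initial condition. -/
def projInit (ψ : FiniteMeasure (Icc (-1 : ℝ) 1) → ℝ) (K : ℕ) (x : DyadicIdx K → ℝ) : ℝ :=
  ψ (dyadicMeasure x)

/-- The matrix `|D_K|⁻² (g(k k'))`. -/
def kernelMatrix (g : ℝ → ℝ) (K : ℕ) : Matrix (DyadicIdx K) (DyadicIdx K) ℝ :=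
  fun k k' => (1 / (Fintype.card (DyadicIdx K) : ℝ) ^ 2) *
    g ((dyadicPoint k : ℝ) * (dyadicPoint k' : ℝ))

/-- `f` is a viscosity solution of `∂ₜ f = H(∇ f)` in the class `MemLUnif`, with initial
condition `ψ₀` on the closed orthant. -/
def IsSolutionFrom {ι : Type*} [Fintype ι] [DecidableEq ι] (H ψ₀ : (ι → ℝ) → ℝ)
    (f : ℝ → (ι → ℝ) → ℝ) : Prop :=
  IsViscositySolution H f ∧ MemLUnif f ∧ ∀ x ∈ orthant ι, f 0 x = ψ₀ x

end

end ProjHJ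

open ProjHJ

/-!
Why the theorem holds. The extension of the non-linearity is admissible because on the cone
`C (G x) - C (G x') = (1/2) (G x - G x') · (x + x')`: as the kernel is bounded below by `m > 0`,
the norm of `x` is controlled by that of `G x`, so `C` is monotone and locally Lipschitz, and every
vector is dominated by a multiple of `G 1` of comparable norm
(`isAdmissibleExtension_extNonlinearity`).

For the equation, only two properties of `H` matter: it is non-decreasing and Lipschitz. The first
one makes information travel along non-negative directions only, which is why the boundary of the
orthant needs no condition.

*Uniqueness.* In the doubling of variables, both copies may be kept off the boundary by adding
`η ∑ 1 / x k` to the penalization: its derivative is negative, so the monotonicity of `H` lets it be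
dropped from the viscosity inequality of the subsolution, and symmetrically for the supersolution
(`SubTest.le_of_isLocalMaxOn`, `comparison`).

*Existence.* The explicit scheme `u + h H (forward differences of u)` stays in the orthant, is
monotone when the space step is at least a multiple of the time step, and commutes with translations
and constants. The approximations are therefore uniformly Lipschitz in space and, up to one time
step, in time, and converge along an ultrafilter. A test function violating the subsolution inequality for the limit is, by
strict differentiability, a strict supersolution of the scheme near the contact point; comparison on
the domain of dependence gives a contradiction (`IsUpwindLimit.subTest`). The supersolution
property follows by applying this to `p ↦ -H (-p)`.

*Gradient.* For a closed convex set `𝒦`, having the gradient in `𝒦` amounts to the bounds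
`u (x + z) ≤ u x + c` whenever `p · z ≤ c` on `𝒦` (`HasGradientIn.incrementLE` and
`hasGradientIn_of_incrementLE`). The scheme propagates each such bound: all the points that it
visits from `x` and `x + z` remain in the orthant, even if `z` has negative coordinates. The same
fact for the bounds `c = M ‖z‖₁` gives the conservation of the Lipschitz constant.
-/

namespace ProjHJ

open Filter Topology

/-! ### The normalized norms -/

section Norms

variable {ι : Type*} [Fintype ι]

theorem normL1_nonneg (x : ι → ℝ) : 0 ≤ normL1 x :=
  mul_nonneg (by positivity) (Finset.sum_nonneg fun _ _ => abs_nonneg _)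

theorem normL1_of_nonneg {x : ι → ℝ} (hx : x ∈ orthant ι) :
    normL1 x = (1 / (Fintype.card ι : ℝ)) * ∑ k, x k := by
  rw [normL1, Finset.sum_congr rfl fun k _ => abs_of_nonneg (hx k)]

theorem normL1_sub_comm (x y : ι → ℝ) : normL1 (x - y) = normL1 (y - x) := by
  simp only [normL1, Pi.sub_apply, abs_sub_comm]

theorem normL1_add_le (x y : ι → ℝ) : normL1 (x + y) ≤ normL1 x + normL1 y := by
  rw [normL1, normL1, normL1, ← mul_add, ← Finset.sum_add_distrib]
  gcongr
  exact abs_add_le _ _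

variable [Nonempty ι]

theorem card_pos_real : (0 : ℝ) < Fintype.card ι := by exact_mod_cast Fintype.card_pos

theorem card_mul_normL1 (x : ι → ℝ) : (Fintype.card ι : ℝ) * normL1 x = ∑ k, |x k| := by
  have := card_pos_real (ι := ι)
  rw [normL1]; field_simp

theorem normL1_pos {x : ι → ℝ} (hx : x ≠ 0) : 0 < normL1 x := by
  obtain ⟨k, hk⟩ := Function.ne_iff.1 hx
  have := card_pos_real (ι := ι)
  refine mul_pos (by positivity) (Finset.sum_pos' (fun _ _ => abs_nonneg _) ⟨k, Finset.mem_univ _, ?_⟩)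
  simpa using hk

theorem normL1Star_eq (y : ι → ℝ) : normL1Star y = Fintype.card ι * ‖y‖ := by
  apply le_antisymm
  · exact ciSup_le fun k => mul_le_mul_of_nonneg_left (norm_le_pi_norm y k) (by positivity)
  · rw [← le_div_iff₀' card_pos_real]
    have hb : BddAbove (range fun k => (Fintype.card ι : ℝ) * |y k|) := Set.finite_range _ |>.bddAbove
    refine (pi_norm_le_iff_of_nonempty _).2 fun k => ?_
    rw [le_div_iff₀' card_pos_real]
    exact le_ciSup hb k

theorem card_mul_abs_le_normL1Star (y : ι → ℝ) (k : ι) :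
    (Fintype.card ι : ℝ) * |y k| ≤ normL1Star y := by
  rw [normL1Star_eq]
  exact mul_le_mul_of_nonneg_left (norm_le_pi_norm y k) (by positivity)

theorem normL1Star_nonneg (y : ι → ℝ) : 0 ≤ normL1Star y := by
  rw [normL1Star_eq]; positivity

theorem normL1Star_zero : normL1Star (0 : ι → ℝ) = 0 := by
  rw [normL1Star_eq]; simp

theorem normL1Star_sub_comm (y z : ι → ℝ) : normL1Star (y - z) = normL1Star (z - y) := by
  rw [normL1Star_eq, normL1Star_eq, norm_sub_rev]

theorem normL1Star_le_add (y z : ι → ℝ) : normL1Star y ≤ normL1Star z + normL1Star (y - z) := by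
  simp only [normL1Star_eq, ← mul_add]
  gcongr
  simpa using norm_add_le z (y - z)

/-- The two normalized norms are dual to each other for the standard pairing. -/
theorem dotProduct_le_normL1Star_mul_normL1 (y x : ι → ℝ) :
    y ⬝ᵥ x ≤ normL1Star y * normL1 x := by
  rw [normL1Star_eq, mul_comm (Fintype.card ι : ℝ), mul_assoc, card_mul_normL1, Finset.mul_sum]
  refine Finset.sum_le_sum fun k _ => (le_abs_self _).trans ?_
  rw [abs_mul]
  exact mul_le_mul_of_nonneg_right (norm_le_pi_norm y k) (abs_nonneg _)

end Norms

/-! ### The extension of the non-linearity -/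

section Extension

variable {ι : Type*} [Fintype ι] {G : Matrix ι ι ℝ} {m R : ℝ}

theorem coneNonlinearity_sub (hG : G.IsSymm) {x x' : ι → ℝ} (hx : x ∈ orthant ι)
    (hx' : x' ∈ orthant ι) :
    coneNonlinearity G (G *ᵥ x) - coneNonlinearity G (G *ᵥ x') =
      (1 / 2) * ((G *ᵥ x - G *ᵥ x') ⬝ᵥ (x + x')) := by
  have key : (G *ᵥ x) ⬝ᵥ x' = (G *ᵥ x') ⬝ᵥ x := by
    rw [dotProduct_comm, Matrix.dotProduct_mulVec, ← Matrix.mulVec_transpose, hG.eq]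
  rw [coneNonlinearity_mulVec hG hx, coneNonlinearity_mulVec hG hx', sub_dotProduct,
    dotProduct_add, dotProduct_add, key]
  ring

omit [Fintype ι] in
theorem zero_mem_orthant : (0 : ι → ℝ) ∈ orthant ι := fun _ => le_rfl

theorem coneNonlinearity_zero (hG : G.IsSymm) : coneNonlinearity G 0 = 0 := by
  have := coneNonlinearity_mulVec hG (zero_mem_orthant (ι := ι))
  simpa using this

variable [Nonempty ι]

/-- A symmetric kernel bounded below is coercive on the orthant: `‖x‖₁ ≤ ‖G x‖ / m`. -/
theorem mul_normL1_le (hlow : ∀ k k', m / (Fintype.card ι : ℝ) ^ 2 ≤ G k k') {x : ι → ℝ}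
    (hx : x ∈ orthant ι) (k : ι) : m * normL1 x ≤ Fintype.card ι * (G *ᵥ x) k := by
  have hd := card_pos_real (ι := ι)
  have h : ∑ k', m / (Fintype.card ι : ℝ) ^ 2 * x k' ≤ (G *ᵥ x) k :=
    Finset.sum_le_sum fun k' _ => mul_le_mul_of_nonneg_right (hlow k k') (hx k')
  rw [← Finset.mul_sum] at h
  calc m * normL1 x = Fintype.card ι * (m / (Fintype.card ι : ℝ) ^ 2 * ∑ k', x k') := by
        rw [normL1_of_nonneg hx]; field_simp
    _ ≤ _ := mul_le_mul_of_nonneg_left h hd.le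

theorem normL1_le_div (hm : 0 < m) (hlow : ∀ k k', m / (Fintype.card ι : ℝ) ^ 2 ≤ G k k')
    {x : ι → ℝ} (hx : x ∈ orthant ι) : normL1 x ≤ normL1Star (G *ᵥ x) / m := by
  rw [le_div_iff₀' hm]
  obtain ⟨k⟩ := ‹Nonempty ι›
  have : Nonempty ι := ⟨k⟩
  refine (mul_normL1_le hlow hx k).trans (le_trans ?_ (card_mul_abs_le_normL1Star _ k))
  exact mul_le_mul_of_nonneg_left (le_abs_self _) (by positivity)

omit [Nonempty ι] in
theorem coneNonlinearity_mono (hG : G.IsSymm) {y w : ι → ℝ} (hy : y ∈ cone G) (hw : w ∈ cone G)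
    (hyw : y ≤ w) : coneNonlinearity G y ≤ coneNonlinearity G w := by
  obtain ⟨x, hx, rfl⟩ := hy
  obtain ⟨x', hx', rfl⟩ := hw
  rw [← sub_nonneg, coneNonlinearity_sub hG hx' hx]
  refine mul_nonneg (by norm_num) (Finset.sum_nonneg fun k _ => mul_nonneg ?_ ?_)
  · exact sub_nonneg.2 (hyw k)
  · exact add_nonneg (hx' k) (hx k)

/-- By the polarization identity `coneNonlinearity_sub` and the duality of the two norms, the
non-linearity is Lipschitz on bounded parts of the cone. -/
theorem coneNonlinearity_sub_le (hG : G.IsSymm) (hm : 0 < m)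
    (hlow : ∀ k k', m / (Fintype.card ι : ℝ) ^ 2 ≤ G k k') {y w : ι → ℝ} (hy : y ∈ cone G)
    (hw : w ∈ cone G) : coneNonlinearity G y - coneNonlinearity G w ≤
      (normL1Star y + normL1Star w) / (2 * m) * normL1Star (y - w) := by
  obtain ⟨x, hx, rfl⟩ := hy
  obtain ⟨x', hx', rfl⟩ := hw
  rw [coneNonlinearity_sub hG hx hx']
  have h1 := dotProduct_le_normL1Star_mul_normL1 (G *ᵥ x - G *ᵥ x') (x + x')
  have h2 : normL1 (x + x') ≤ (normL1Star (G *ᵥ x) + normL1Star (G *ᵥ x')) / m := by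
    rw [add_div]
    exact (normL1_add_le x x').trans
      (add_le_add (normL1_le_div hm hlow hx) (normL1_le_div hm hlow hx'))
  have h3 := mul_le_mul_of_nonneg_left h2 (normL1Star_nonneg (G *ᵥ x - G *ᵥ x'))
  calc _ ≤ 1 / 2 * (normL1Star (G *ᵥ x - G *ᵥ x') *
          ((normL1Star (G *ᵥ x) + normL1Star (G *ᵥ x')) / m)) := by linarith
    _ = _ := by field_simp

omit [Nonempty ι] in
theorem zero_mem_cone : (0 : ι → ℝ) ∈ cone G := ⟨0, zero_mem_orthant, by simp⟩

theorem coneNonlinearity_le (hG : G.IsSymm) (hm : 0 < m)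
    (hlow : ∀ k k', m / (Fintype.card ι : ℝ) ^ 2 ≤ G k k') {y : ι → ℝ} (hy : y ∈ cone G) :
    coneNonlinearity G y ≤ normL1Star y ^ 2 / (2 * m) := by
  have := coneNonlinearity_sub_le hG hm hlow hy (zero_mem_cone (G := G))
  rw [coneNonlinearity_zero hG, normL1Star_zero, sub_zero, sub_zero, add_zero] at this
  calc _ ≤ _ := this
    _ = _ := by ring

theorem coneNonlinearity_nonneg (hG : G.IsSymm) (hm : 0 < m)
    (hlow : ∀ k k', m / (Fintype.card ι : ℝ) ^ 2 ≤ G k k') {y : ι → ℝ} (hy : y ∈ cone G) :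
    0 ≤ coneNonlinearity G y := by
  rw [← coneNonlinearity_zero hG]
  refine coneNonlinearity_mono hG zero_mem_cone hy ?_
  obtain ⟨x, hx, rfl⟩ := hy
  intro k
  have h1 := mul_normL1_le hlow hx k
  have h2 := mul_nonneg hm.le (normL1_nonneg x)
  exact nonneg_of_mul_nonneg_right (h2.trans h1) card_pos_real

theorem regNonlinearity_nonneg (hG : G.IsSymm) (hm : 0 < m) (hR : 0 < R)
    (hlow : ∀ k k', m / (Fintype.card ι : ℝ) ^ 2 ≤ G k k') {y : ι → ℝ} (hy : y ∈ cone G) :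
    0 ≤ regNonlinearity G m R y := by
  rw [regNonlinearity, coneNonlinearity_zero hG]
  split_ifs with h
  · exact le_max_of_le_left (coneNonlinearity_nonneg hG hm hlow hy)
  · have : 0 ≤ normL1Star y - R := by linarith
    positivity

/-- On the cone the regularized non-linearity is Lipschitz: on the sphere of radius `2R` the affine
branch already dominates the quadratic one, so the two definitions match there. -/
theorem regNonlinearity_sub_le (hG : G.IsSymm) (hm : 0 < m) (hR : 0 < R)
    (hlow : ∀ k k', m / (Fintype.card ι : ℝ) ^ 2 ≤ G k k') {y w : ι → ℝ} (hy : y ∈ cone G)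
    (hw : w ∈ cone G) : regNonlinearity G m R y - regNonlinearity G m R w ≤
      2 * (4 * R / m) * normL1Star (y - w) := by
  have hL : 0 < 2 * (4 * R / m) := by positivity
  have htri := normL1Star_le_add y w
  have hyw := normL1Star_nonneg (y - w)
  have haff : 2 * (4 * R / m) * (normL1Star y - R) - 2 * (4 * R / m) * (normL1Star w - R) ≤
      2 * (4 * R / m) * normL1Star (y - w) := by
    rw [← mul_sub]; gcongr; linarith
  have hmul := mul_nonneg hL.le hyw
  simp only [regNonlinearity, coneNonlinearity_zero hG, zero_add]
  split_ifs with h1 h2 h2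
  · rw [sub_le_iff_le_add]
    refine max_le ?_ ?_
    · have h3 := coneNonlinearity_sub_le hG hm hlow hy hw
      have h4 : (normL1Star y + normL1Star w) / (2 * m) ≤ 2 * (4 * R / m) := by
        rw [div_le_iff₀ (by positivity)]
        field_simp
        linarith
      have h5 := mul_le_mul_of_nonneg_right h4 hyw
      have h6 := le_max_left (coneNonlinearity G w) (2 * (4 * R / m) * (normL1Star w - R))
      linarith
    · have h6 := le_max_right (coneNonlinearity G w) (2 * (4 * R / m) * (normL1Star w - R))
      linarith
  · rw [sub_le_iff_le_add]
    refine max_le ?_ (by linarith)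
    have h3 := coneNonlinearity_le hG hm hlow hy
    have h4 : normL1Star y ^ 2 / (2 * m) ≤ 2 * (4 * R / m) * R := by
      rw [div_le_iff₀ (by positivity)]
      field_simp
      nlinarith [normL1Star_nonneg y]
    have h5 : 2 * (4 * R / m) * R ≤ 2 * (4 * R / m) * (normL1Star w - R) := by
      gcongr; linarith
    linarith
  · have h6 := le_max_right (coneNonlinearity G w) (2 * (4 * R / m) * (normL1Star w - R))
    linarith
  · exact haff

theorem isAdmissibleExtension_extNonlinearity (hG : G.IsSymm) (hm : 0 < m) (hR : 0 < R)
    (hlow : ∀ k k', m / (Fintype.card ι : ℝ) ^ 2 ≤ G k k') :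
    IsAdmissibleExtension G R (extNonlinearity G m R) := by
  have hd := card_pos_real (ι := ι)
  have hone : (fun _ => 1 : ι → ℝ) ∈ orthant ι := fun _ => zero_le_one
  have hbdd : ∀ y : ι → ℝ, BddBelow {r | ∃ w ∈ cone G, y ≤ w ∧ r = regNonlinearity G m R w} := by
    rintro y
    refine ⟨0, ?_⟩
    rintro r ⟨w, hw, -, rfl⟩
    exact regNonlinearity_nonneg hG hm hR hlow hw
  -- a multiple of `G 1` dominates any given vector, with a linear control of its norm
  have hdom : ∀ (z : ι → ℝ) (w : ι → ℝ), w ∈ cone G →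
      ∃ w' ∈ cone G, w + z ≤ w' ∧
        normL1Star (w' - w) ≤ normL1Star (G *ᵥ fun _ => 1) / m * normL1Star z := by
    rintro z w ⟨x, hx, rfl⟩
    have hc : 0 ≤ normL1Star z / m := div_nonneg (normL1Star_nonneg z) hm.le
    refine ⟨G *ᵥ (x + (normL1Star z / m) • fun _ => 1), ⟨_, fun k => ?_, rfl⟩, fun k => ?_, ?_⟩
    · simpa using add_nonneg (hx k) hc
    · rw [Matrix.mulVec_add, Matrix.mulVec_smul]
      simp only [Pi.add_apply, Pi.smul_apply, smul_eq_mul, add_le_add_iff_left]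
      have h1 := mul_normL1_le hlow hone k
      have h2 : normL1 (fun _ => 1 : ι → ℝ) = 1 := by
        simp [normL1]
      rw [h2, mul_one] at h1
      have h3 := card_mul_abs_le_normL1Star z k
      have h4 := mul_le_mul_of_nonneg_left h1 hc
      rw [div_mul_cancel₀ _ hm.ne'] at h4
      have h5 : (Fintype.card ι : ℝ) * z k ≤
          Fintype.card ι * (normL1Star z / m * (G *ᵥ fun _ => 1) k) := by
        have := mul_le_mul_of_nonneg_left (le_abs_self (z k)) hd.le
        linarith
      exact le_of_mul_le_mul_left h5 hd
    · rw [Matrix.mulVec_add, Matrix.mulVec_smul, add_sub_cancel_left, normL1Star_eq, norm_smul,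
        normL1Star_eq (G *ᵥ _), Real.norm_of_nonneg hc]
      apply le_of_eq; ring
  have hne : ∀ y : ι → ℝ, {r | ∃ w ∈ cone G, y ≤ w ∧ r = regNonlinearity G m R w}.Nonempty := by
    intro y
    obtain ⟨w, hw, hyw, -⟩ := hdom y 0 zero_mem_cone
    exact ⟨_, w, hw, by simpa using hyw, rfl⟩
  have hlip : ∀ y y' : ι → ℝ, extNonlinearity G m R y - extNonlinearity G m R y' ≤
      2 * (4 * R / m) * (normL1Star (G *ᵥ fun _ => 1) / m) * normL1Star (y - y') := by
    intro y y'
    rw [sub_le_comm]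
    refine le_csInf (hne y') ?_
    rintro r ⟨w, hw, hyw, rfl⟩
    obtain ⟨w', hw', h1, h2⟩ := hdom (y - y') w hw
    have h3 : extNonlinearity G m R y ≤ regNonlinearity G m R w' := by
      refine csInf_le (hbdd y) ⟨w', hw', fun k => ?_, rfl⟩
      have := h1 k
      have := hyw k
      simp only [Pi.add_apply, Pi.sub_apply] at *
      linarith
    have h4 := regNonlinearity_sub_le hG hm hR hlow hw' hw
    have h5 : 2 * (4 * R / m) * normL1Star (w' - w) ≤
        2 * (4 * R / m) * (normL1Star (G *ᵥ fun _ => 1) / m * normL1Star (y - y')) := by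
      gcongr
    linarith
  refine ⟨fun y y' hyy' => ?_, ⟨_, fun y y' => abs_le.2 ⟨?_, hlip y y'⟩⟩, fun y hy hyR => ?_⟩
  · refine csInf_le_csInf (hbdd y) (hne y') ?_
    rintro r ⟨w, hw, hyw, rfl⟩
    exact ⟨w, hw, hyy'.trans hyw, rfl⟩
  · have := hlip y' y
    rw [normL1Star_sub_comm] at this
    linarith
  · have hCy := coneNonlinearity_nonneg hG hm hlow hy
    have hL : 0 < 2 * (4 * R / m) := by positivity
    apply le_antisymm
    · refine (csInf_le (hbdd y) ⟨y, hy, le_rfl, rfl⟩).trans ?_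
      rw [regNonlinearity, if_pos (by linarith), coneNonlinearity_zero hG, zero_add]
      refine max_le le_rfl (le_trans ?_ hCy)
      exact mul_nonpos_of_nonneg_of_nonpos hL.le (by linarith)
    · refine le_csInf (hne y) ?_
      rintro r ⟨w, hw, hyw, rfl⟩
      rw [regNonlinearity, coneNonlinearity_zero hG]
      split_ifs with h
      · exact le_max_of_le_left (coneNonlinearity_mono hG hy hw hyw)
      · have h3 := coneNonlinearity_le hG hm hlow hy
        have h4 : normL1Star y ^ 2 / (2 * m) ≤ 2 * (4 * R / m) * R := by
          rw [div_le_iff₀ (by positivity)]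
          field_simp
          nlinarith [normL1Star_nonneg y]
        have h5 : 2 * (4 * R / m) * R ≤ 2 * (4 * R / m) * (normL1Star w - R) := by
          gcongr; linarith
        linarith

end Extension

/-! ### Gradients in a closed convex set -/

section Gradient

variable {ι : Type*} [Fintype ι]

/-- A bound on the derivative in direction `z`, valid almost everywhere in a convex open set, bounds
the increments along `z`: averaging over a small ball turns the function into a differentiable one. -/
theorem sub_le_of_ae_fderiv_le {h : (ι → ℝ) → ℝ} {C : ℝ≥0}
    (hh : LipschitzWith C h) {U : Set (ι → ℝ)} (hU : IsOpen U) (hconv : Convex ℝ U) {z : ι → ℝ} {c : ℝ}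
    (hae : ∀ᵐ x, x ∈ U → fderiv ℝ h x z ≤ c) {x : ι → ℝ} (hx : x ∈ U) (hxz : x + z ∈ U) :
    h (x + z) - h x ≤ c := by
  by_contra! hcon
  set θ := h (x + z) - h x - c with hθ
  have hθ0 : 0 < θ := by simp only [hθ]; linarith
  have hcont : Continuous fun y => h (y + z) - h y :=
    (hh.continuous.comp (continuous_id.add continuous_const)).sub hh.continuous
  have hev : ∀ᶠ y in 𝓝 x, y ∈ U ∧ y + z ∈ U ∧ c + θ / 2 < h (y + z) - h y := by
    refine Eventually.and (hU.mem_nhds hx) (Eventually.and ?_ ?_)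
    · exact (continuous_id.add continuous_const).continuousAt.eventually (hU.mem_nhds hxz)
    · refine hcont.continuousAt.eventually (lt_mem_nhds ?_)
      simp only [hθ]; linarith
  obtain ⟨r, hr, hball⟩ := Metric.eventually_nhds_iff_ball.1 hev
  set B := Metric.ball x r with hB
  have hvol : 0 < volume.real B :=
    ENNReal.toReal_pos (Metric.measure_ball_pos _ _ hr).ne' measure_ball_lt_top.ne
  have hfin : IsFiniteMeasure (volume.restrict B) := ⟨by
    rw [Measure.restrict_apply_univ]; exact measure_ball_lt_top⟩
  have hint : ∀ w : ι → ℝ, Integrable (fun y => h (y + w)) (volume.restrict B) := fun w =>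
    ((hh.continuous.comp (continuous_id.add continuous_const)).continuousOn.integrableOn_compact
      (isCompact_closedBall x r)).mono_set Metric.ball_subset_closedBall
  have hderiv : ∀ s : ℝ, Integrable (fun y => fderiv ℝ h (y + s • z) z) (volume.restrict B) ∧
      HasDerivAt (fun s : ℝ => ∫ y in B, h (y + s • z)) (∫ y in B, fderiv ℝ h (y + s • z) z) s := by
    intro s
    refine hasDerivAt_integral_of_dominated_loc_of_lip (F := fun (s : ℝ) y => h (y + s • z))
      (bound := fun _ => C * ‖z‖) univ_mem (Eventually.of_forall fun t => (hint _).1) (hint _)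
      ?_ ?_ (integrable_const _) ?_
    · exact ((measurable_fderiv_apply_const ℝ h z).comp
        (measurable_id.add_const _)).aestronglyMeasurable
    · refine Eventually.of_forall fun y => LipschitzOnWith.of_dist_le_mul fun t _ t' _ => ?_
      refine (hh.dist_le_mul _ _).trans (le_of_eq ?_)
      rw [dist_add_left, dist_eq_norm, ← sub_smul, norm_smul, Real.coe_nnabs,
        abs_of_nonneg (by positivity), Real.dist_eq, Real.norm_eq_abs]
      ring
    · have h1 := (measurePreserving_add_right (volume : Measure (ι → ℝ))
        (s • z)).quasiMeasurePreserving.ae hh.ae_differentiableAt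
      refine ae_restrict_of_ae (h1.mono fun y hy => ?_)
      have h2 : HasDerivAt (fun s : ℝ => y + s • z) z s := by
        simpa using ((hasDerivAt_id s).smul_const z).const_add y
      exact (hy.hasFDerivAt).comp_hasDerivAt s h2
  have hle : ∀ s ∈ Icc (0 : ℝ) 1, ∫ y in B, fderiv ℝ h (y + s • z) z ≤ c * volume.real B := by
    intro s hs
    have h1 := (measurePreserving_add_right (volume : Measure (ι → ℝ))
      (s • z)).quasiMeasurePreserving.ae hae
    have h2 : ∫ y in B, fderiv ℝ h (y + s • z) z ≤ ∫ _ in B, c := by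
      refine setIntegral_mono_on_ae (hderiv s).1 (integrable_const _) measurableSet_ball ?_
      refine h1.mono fun y hy hyB => hy ?_
      obtain ⟨h3, h4, -⟩ := hball y hyB
      have := hconv h3 h4 (sub_nonneg.2 hs.2) hs.1 (by ring)
      convert this using 1
      module
    simpa [mul_comm] using h2
  have hmv := (convex_Icc (0 : ℝ) 1).image_sub_le_mul_sub_of_deriv_le
    (f := fun s : ℝ => ∫ y in B, h (y + s • z)) (C := c * volume.real B)
    (fun s _ => (hderiv s).2.continuousAt.continuousWithinAt)
    (fun s _ => (hderiv s).2.differentiableAt.differentiableWithinAt)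
    (fun s hs => by rw [(hderiv s).2.deriv]; exact hle s (interior_subset hs))
    0 (by simp) 1 (by simp) zero_le_one
  have hlow : (c + θ / 2) * volume.real B ≤ ∫ y in B, (h (y + z) - h y) := by
    have h2 : ∫ _ in B, (c + θ / 2) ≤ ∫ y in B, (h (y + z) - h y) := by
      refine setIntegral_mono_on (integrable_const _) ((hint z).sub (by simpa using hint 0))
        measurableSet_ball fun y hy => (hball y hy).2.2.le
    simpa [mul_comm] using h2
  rw [integral_sub (hint z) (by simpa using hint 0)] at hlow
  simp only [one_smul, zero_smul, add_zero, sub_zero, mul_one] at hmv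
  nlinarith

theorem isOpen_openOrthant : IsOpen (openOrthant ι) := by
  have : openOrthant ι = ⋂ k, {x | 0 < x k} := by ext; simp [openOrthant]
  rw [this]
  exact isOpen_iInter_of_finite fun k => isOpen_lt continuous_const (continuous_apply k)

omit [Fintype ι] in
theorem convex_openOrthant : Convex ℝ (openOrthant ι) := by
  intro x hx y hy a b ha hb hab k
  rcases ha.eq_or_lt with rfl | ha
  · have : b = 1 := by linarith
    simpa [this] using hy k
  · have := mul_pos ha (hx k)
    have := mul_nonneg hb (hy k).le
    simp only [Pi.add_apply, Pi.smul_apply, smul_eq_mul]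
    linarith

omit [Fintype ι] in
theorem openOrthant_subset : openOrthant ι ⊆ orthant ι := fun _ hx k => (hx k).le

/-- The boundary of the orthant is negligible. -/
theorem ae_mem_openOrthant : ∀ᵐ x ∂(volume.restrict (orthant ι)), x ∈ openOrthant ι := by
  have h0 : ∀ᵐ x : ι → ℝ, ∀ k, x k ≠ 0 := by
    rw [ae_all_iff]
    intro k
    rw [ae_iff, volume_pi]
    simpa only [not_not, ne_eq] using Measure.pi_hyperplane (fun _ : ι => (volume : Measure ℝ)) k 0
  have hmeas : MeasurableSet (orthant ι) := by
    have : orthant ι = ⋂ k, {x | 0 ≤ x k} := by ext; simp [orthant]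
    rw [this]
    exact MeasurableSet.iInter fun k => measurableSet_le measurable_const (measurable_pi_apply k)
  rw [ae_restrict_iff' hmeas]
  exact h0.mono fun x hx hxo k => (hxo k).lt_of_ne' (hx k)

/-- The increments of `u` along the vector `z`, within the orthant, are at most `c`. -/
def IncrementLE (u : (ι → ℝ) → ℝ) (z : ι → ℝ) (c : ℝ) : Prop :=
  ∀ x ∈ orthant ι, x + z ∈ orthant ι → u (x + z) ≤ u x + c

variable [DecidableEq ι]

theorem grad_dotProduct (h : (ι → ℝ) → ℝ) (x z : ι → ℝ) : grad h x ⬝ᵥ z = fderiv ℝ h x z := by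
  conv_rhs => rw [← Finset.univ_sum_single z, map_sum]
  refine Finset.sum_congr rfl fun k _ => ?_
  have : Pi.single k (z k) = z k • (Pi.single k 1 : ι → ℝ) := by
    rw [← Pi.single_smul]; simp
  rw [this, map_smul, smul_eq_mul, mul_comm, grad]

/-- The gradient constraint in integrated form, as a bound on increments that may be propagated by a
monotone scheme. -/
theorem HasGradientIn.incrementLE {h : (ι → ℝ) → ℝ} {C : ℝ≥0} (hh : LipschitzOnWith C h (orthant ι))
    {𝒦 : Set (ι → ℝ)} (hK : HasGradientIn h 𝒦) {z : ι → ℝ} {c : ℝ} (hz : ∀ p ∈ 𝒦, p ⬝ᵥ z ≤ c) :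
    IncrementLE h z c := by
  obtain ⟨g, hg, heq⟩ := hh.extend_real
  have hae : ∀ᵐ x, x ∈ openOrthant ι → fderiv ℝ g x z ≤ c := by
    have h1 : ∀ᵐ x ∂(volume.restrict (openOrthant ι)), DifferentiableAt ℝ h x ∧ grad h x ∈ 𝒦 :=
      ae_mono (Measure.restrict_mono openOrthant_subset le_rfl) hK
    rw [ae_restrict_iff' isOpen_openOrthant.measurableSet] at h1
    refine h1.mono fun x hx hxo => ?_
    have h2 : g =ᶠ[𝓝 x] h := by
      filter_upwards [isOpen_openOrthant.mem_nhds hxo] with y hy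
      exact (heq (openOrthant_subset hy)).symm
    rw [h2.fderiv_eq, ← grad_dotProduct]
    exact hz _ (hx hxo).2
  intro x hx hxz
  rw [heq hx, heq hxz]
  -- shift the two points inside the open orthant
  have hlim : ∀ y : ι → ℝ, Tendsto (fun δ : ℝ => g (y + fun _ => δ)) (𝓝[>] 0) (𝓝 (g y)) := by
    intro y
    have h1 : Continuous fun δ : ℝ => g (y + fun _ => δ) := by
      have := hg.continuous
      fun_prop
    have h2 := h1.tendsto 0
    have h3 : (y + fun _ => (0 : ℝ)) = y := by ext; simp
    rw [h3] at h2
    exact h2.mono_left nhdsWithin_le_nhds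
  refine le_of_tendsto_of_tendsto (hlim (x + z)) ((hlim x).add_const c) ?_
  filter_upwards [self_mem_nhdsWithin] with δ hδ
  have hδ : 0 < δ := hδ
  have h4 := sub_le_of_ae_fderiv_le hg isOpen_openOrthant convex_openOrthant hae
    (x := x + fun _ => δ) (fun k => add_pos_of_nonneg_of_pos (hx k) hδ)
    (by rw [add_right_comm]; exact fun k => add_pos_of_nonneg_of_pos (hxz k) hδ)
  rw [add_right_comm] at h4
  linarith

/-- By the Hahn-Banach theorem, bounding all increments by the support function of a closed convex
set forces the gradient into this set. -/
theorem hasGradientIn_of_incrementLE {h : (ι → ℝ) → ℝ} {C : ℝ≥0}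
    (hh : LipschitzOnWith C h (orthant ι)) {𝒦 : Set (ι → ℝ)} (hconv : Convex ℝ 𝒦)
    (hclosed : IsClosed 𝒦) (hinc : ∀ z c, (∀ p ∈ 𝒦, p ⬝ᵥ z ≤ c) → IncrementLE h z c) :
    HasGradientIn h 𝒦 := by
  obtain ⟨g, hg, heq⟩ := hh.extend_real
  filter_upwards [ae_mem_openOrthant, ae_restrict_of_ae hg.ae_differentiableAt] with x hxo hdiff
  have h2 : h =ᶠ[𝓝 x] g := by
    filter_upwards [isOpen_openOrthant.mem_nhds hxo] with y hy
    exact heq (openOrthant_subset hy)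
  have hd : DifferentiableAt ℝ h x := h2.differentiableAt_iff.2 hdiff
  refine ⟨hd, ?_⟩
  by_contra hnot
  obtain ⟨F, c, hlt, hgt⟩ := geometric_hahn_banach_closed_point hconv hclosed hnot
  set z : ι → ℝ := fun k => F (Pi.single k 1) with hz
  have hF : ∀ p : ι → ℝ, F p = p ⬝ᵥ z := by
    intro p
    conv_lhs => rw [← Finset.univ_sum_single p, map_sum]
    refine Finset.sum_congr rfl fun k _ => ?_
    have : Pi.single k (p k) = p k • (Pi.single k 1 : ι → ℝ) := by
      rw [← Pi.single_smul]; simp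
    rw [this, map_smul, smul_eq_mul]
  rw [hF, grad_dotProduct] at hgt
  have hline : HasDerivAt (fun s : ℝ => h (x + s • z)) (fderiv ℝ h x z) 0 := by
    have h3 : HasDerivAt (fun s : ℝ => x + s • z) z 0 := by
      simpa using ((hasDerivAt_id (0 : ℝ)).smul_const z).const_add x
    exact HasFDerivAt.comp_hasDerivAt (0 : ℝ) (by simpa using hd.hasFDerivAt) h3
  have hle : fderiv ℝ h x z ≤ c := by
    have h4 := hline.tendsto_slope_zero_right
    refine le_of_tendsto h4 ?_
    have h5 : ∀ᶠ s : ℝ in 𝓝[>] 0, x + s • z ∈ openOrthant ι := by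
      have h6 : Continuous fun s : ℝ => x + s • z := by fun_prop
      refine (h6.continuousAt.eventually (isOpen_openOrthant.mem_nhds ?_)).filter_mono
        nhdsWithin_le_nhds
      simpa using hxo
    filter_upwards [h5, self_mem_nhdsWithin] with s hs hs0
    have hs0 : 0 < s := hs0
    have h7 := hinc (s • z) (s * c) (fun p hp => by
      rw [dotProduct_smul, smul_eq_mul]
      exact mul_le_mul_of_nonneg_left ((hF p).symm.trans_lt (hlt p hp)).le hs0.le) x
      (openOrthant_subset hxo) (openOrthant_subset hs)
    simp only [zero_add, zero_smul, add_zero, smul_eq_mul]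
    rw [inv_mul_le_iff₀ hs0]
    linarith
  linarith

variable [Nonempty ι] {G : Matrix ι ι ℝ}

omit [DecidableEq ι] in
theorem isCompact_normL1_le (a : ℝ) : IsCompact {x ∈ orthant ι | normL1 x ≤ a} := by
  refine Metric.isCompact_of_isClosed_isBounded ?_ ?_
  · have h1 : IsClosed (orthant ι) := by
      have : orthant ι = ⋂ k, {x | 0 ≤ x k} := by ext; simp [orthant]
      rw [this]
      exact isClosed_iInter fun k => isClosed_le continuous_const (continuous_apply k)
    refine h1.inter (isClosed_le (f := normL1) (g := fun _ => a) ?_ continuous_const)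
    unfold normL1
    fun_prop
  · refine (Metric.isBounded_closedBall (x := (0 : ι → ℝ)) (r := Fintype.card ι * a)).subset ?_
    rintro x ⟨hx, hxa⟩
    have hd := card_pos_real (ι := ι)
    rw [mem_closedBall_zero_iff, pi_norm_le_iff_of_nonempty]
    intro k
    have h1 : |x k| ≤ ∑ k, |x k| :=
      Finset.single_le_sum (f := fun k => |x k|) (fun _ _ => abs_nonneg _) (Finset.mem_univ k)
    rw [← card_mul_normL1] at h1
    exact h1.trans (mul_le_mul_of_nonneg_left hxa hd.le)

omit [DecidableEq ι] in
theorem enlarge_eq (𝒦 : Set (ι → ℝ)) : enlarge 𝒦 =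
    (fun q : (ι → ℝ) × (ι → ℝ) => q.1 + q.2) ''
      (𝒦 ×ˢ Metric.closedBall 0 (1 / √(Fintype.card ι : ℝ) / Fintype.card ι)) := by
  have hd := card_pos_real (ι := ι)
  have key : ∀ w : ι → ℝ, normL1Star w ≤ 1 / √(Fintype.card ι : ℝ) ↔
      w ∈ Metric.closedBall 0 (1 / √(Fintype.card ι : ℝ) / Fintype.card ι) := fun w => by
    rw [mem_closedBall_zero_iff, le_div_iff₀' hd, normL1Star_eq]
  ext y
  constructor
  · rintro ⟨z, hz, hyz⟩
    exact ⟨(z, y - z), ⟨hz, (key _).1 hyz⟩, by simp⟩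
  · rintro ⟨⟨z, w⟩, ⟨hz, hw⟩, rfl⟩
    exact ⟨z, hz, by simpa using (key _).2 hw⟩

omit [DecidableEq ι] [Nonempty ι] in
theorem coneBall_eq (G : Matrix ι ι ℝ) (a : ℝ) :
    coneBall G a = Matrix.mulVecLin G '' {x ∈ orthant ι | normL1 x ≤ a} := by
  ext y
  simp only [coneBall, mem_ofPred_eq, mem_image, Matrix.mulVecLin_apply, and_assoc]

omit [DecidableEq ι] in
theorem isClosed_enlarge_coneBall (G : Matrix ι ι ℝ) (a : ℝ) :
    IsClosed (enlarge (coneBall G a)) := by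
  rw [enlarge_eq, coneBall_eq]
  refine IsCompact.isClosed (((isCompact_normL1_le a).image ?_).prod
    (isCompact_closedBall _ _) |>.image (by fun_prop))
  exact LinearMap.continuous_of_finiteDimensional _

omit [DecidableEq ι] in
theorem convex_enlarge_coneBall (G : Matrix ι ι ℝ) (a : ℝ) :
    Convex ℝ (enlarge (coneBall G a)) := by
  rw [enlarge_eq, coneBall_eq]
  have h1 : Convex ℝ {x ∈ orthant ι | normL1 x ≤ a} := by
    rintro x ⟨hx, hxa⟩ y ⟨hy, hya⟩ s t hs ht hst
    refine ⟨fun k => add_nonneg (mul_nonneg hs (hx k)) (mul_nonneg ht (hy k)), ?_⟩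
    have hsm : ∀ (s : ℝ) (_ : 0 ≤ s) (x : ι → ℝ), normL1 (s • x) = s * normL1 x := by
      intro s hs x
      simp only [normL1, Pi.smul_apply, smul_eq_mul, abs_mul, abs_of_nonneg hs, ← Finset.mul_sum]
      ring
    refine (normL1_add_le _ _).trans ?_
    rw [hsm s hs, hsm t ht]
    calc s * normL1 x + t * normL1 y ≤ s * a + t * a := by gcongr
      _ = a := by rw [← add_mul, hst, one_mul]
  exact ((h1.linear_image _).prod (convex_closedBall _ _)).is_linear_image
    (IsLinearMap.isLinearMap_add)

end Gradient

/-! ### Comparison principle -/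

section Comparison

variable {ι : Type*} [Fintype ι]

/-- The reflected non-linearity `p ↦ -H (-p)`; it exchanges sub- and supersolutions under `u ↦ -u`. -/
def reflect (H : (ι → ℝ) → ℝ) (p : ι → ℝ) : ℝ := -H (-p)

/-- The differential inequality of a viscosity subsolution, without the semicontinuity. -/
def SubTest [DecidableEq ι] (H : (ι → ℝ) → ℝ) (u : ℝ → (ι → ℝ) → ℝ) : Prop :=
  ∀ φ : ℝ → (ι → ℝ) → ℝ,
    ContDiffOn ℝ ((⊤ : ℕ∞) : WithTop ℕ∞) (fun p : ℝ × (ι → ℝ) => φ p.1 p.2)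
      (Ioi 0 ×ˢ openOrthant ι) →
    ∀ t ∈ Ioi (0 : ℝ), ∀ x ∈ openOrthant ι,
      IsLocalMaxOn (fun p : ℝ × (ι → ℝ) => u p.1 p.2 - φ p.1 p.2)
        (Ioi 0 ×ˢ openOrthant ι) (t, x) →
      deriv (fun s => φ s x) t - H (grad (φ t) x) ≤ 0

/-- The differential inequality of a viscosity supersolution, without the semicontinuity. -/
def SuperTest [DecidableEq ι] (H : (ι → ℝ) → ℝ) (v : ℝ → (ι → ℝ) → ℝ) : Prop :=
  ∀ φ : ℝ → (ι → ℝ) → ℝ,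
    ContDiffOn ℝ ((⊤ : ℕ∞) : WithTop ℕ∞) (fun p : ℝ × (ι → ℝ) => φ p.1 p.2)
      (Ioi 0 ×ˢ openOrthant ι) →
    ∀ t ∈ Ioi (0 : ℝ), ∀ x ∈ openOrthant ι,
      IsLocalMinOn (fun p : ℝ × (ι → ℝ) => v p.1 p.2 - φ p.1 p.2)
        (Ioi 0 ×ˢ openOrthant ι) (t, x) →
      0 ≤ deriv (fun s => φ s x) t - H (grad (φ t) x)

theorem grad_neg [DecidableEq ι] (h : (ι → ℝ) → ℝ) (x : ι → ℝ) :
    grad (fun y => -h y) x = -grad h x := by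
  ext k
  simp [grad, fderiv_fun_neg]

theorem SuperTest.neg [DecidableEq ι] {H : (ι → ℝ) → ℝ} {v : ℝ → (ι → ℝ) → ℝ}
    (hv : SuperTest H v) : SubTest (reflect H) (fun t x => -v t x) := by
  intro φ hφ t ht x hx hmax
  have h1 := hv (fun t x => -φ t x) hφ.neg t ht x hx (by
    convert hmax.neg using 2
    ext p; simp; ring)
  rw [grad_neg, deriv.fun_neg] at h1
  rw [reflect]
  linarith

theorem SubTest.neg_superTest [DecidableEq ι] {H : (ι → ℝ) → ℝ} {v : ℝ → (ι → ℝ) → ℝ}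
    (hv : SubTest (reflect H) (fun t x => -v t x)) : SuperTest H v := by
  intro φ hφ t ht x hx hmin
  have h1 := hv (fun t x => -φ t x) hφ.neg t ht x hx (by
    convert hmin.neg using 2
    ext p; simp; ring)
  rw [grad_neg, deriv.fun_neg, reflect, neg_neg] at h1
  linarith

/-- The quadratic coupling of the two copies of space-time in the doubling of variables. -/
def coupling (A : ℝ) (p q : ℝ × (ι → ℝ)) : ℝ :=
  A * (p.1 - q.1) ^ 2 + ∑ k, A * (p.2 k - q.2 k) ^ 2

/-- The penalization of large times, of large `x`, and of the boundary of the orthant. -/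
noncomputable def penalty (κ η : ℝ) (p : ℝ × (ι → ℝ)) : ℝ :=
  κ * (p.1 + p.1 ^ 2) + ∑ k, η * (p.2 k + (p.2 k)⁻¹)

theorem coupling_comm (A : ℝ) (p q : ℝ × (ι → ℝ)) : coupling A p q = coupling A q p := by
  unfold coupling
  congr 1
  · ring
  · exact Finset.sum_congr rfl fun k _ => by ring

theorem contDiffOn_coupling_add_penalty (A κ η : ℝ) (q : ℝ × (ι → ℝ)) :
    ContDiffOn ℝ ((⊤ : ℕ∞) : WithTop ℕ∞) (fun p => coupling A p q + penalty κ η p)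
      (Ioi 0 ×ˢ openOrthant ι) := by
  unfold coupling penalty
  have hk : ∀ k, ContDiff ℝ ((⊤ : ℕ∞) : WithTop ℕ∞) fun p : ℝ × (ι → ℝ) => p.2 k := by
    intro k; fun_prop
  refine ContDiffOn.add (ContDiffOn.add (ContDiff.contDiffOn (by fun_prop)) ?_)
    (ContDiffOn.add (ContDiff.contDiffOn (by fun_prop)) ?_)
  · exact ContDiffOn.sum fun k _ => ContDiff.contDiffOn (by fun_prop)
  · refine ContDiffOn.sum fun k _ => contDiffOn_const.mul ((hk k).contDiffOn.add ?_)
    exact (hk k).contDiffOn.inv fun p hp => (hp.2 k).ne'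

theorem hasDerivAt_mul_sub_sq (A b r : ℝ) :
    HasDerivAt (fun s : ℝ => A * (s - b) ^ 2) (2 * A * (r - b)) r := by
  refine ((((hasDerivAt_id' r).sub_const b).fun_pow 2).const_mul A).congr_deriv ?_
  norm_num
  ring

/-- Testing a subsolution against the penalization: the boundary terms have the favourable sign,
since the non-linearity is non-decreasing. -/
theorem SubTest.le_of_isLocalMaxOn [DecidableEq ι] {H : (ι → ℝ) → ℝ}
    (hmono : ∀ y y', y ≤ y' → H y ≤ H y') {u : ℝ → (ι → ℝ) → ℝ} (hu : SubTest H u)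
    {A κ η : ℝ} (hκ : 0 ≤ κ) (hη : 0 ≤ η) {p q : ℝ × (ι → ℝ)} (hp : p ∈ Ioi 0 ×ˢ openOrthant ι)
    (hmax : IsLocalMaxOn (fun p : ℝ × (ι → ℝ) => u p.1 p.2 - (coupling A p q + penalty κ η p))
      (Ioi 0 ×ˢ openOrthant ι) p) :
    2 * A * (p.1 - q.1) + κ ≤ H (fun k => 2 * A * (p.2 k - q.2 k) + η) := by
  obtain ⟨t, x⟩ := p
  obtain ⟨ht, hx⟩ := hp
  have ht : 0 < t := ht
  have hx : x ∈ openOrthant ι := hx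
  have h1 := hu (fun t x => coupling A (t, x) q + penalty κ η (t, x))
    (contDiffOn_coupling_add_penalty A κ η q) t ht x hx hmax
  have hd : HasDerivAt (fun s => coupling A (s, x) q + penalty κ η (s, x))
      (2 * A * (t - q.1) + κ * (1 + 2 * t)) t := by
    unfold coupling penalty
    have e1 := hasDerivAt_mul_sub_sq A q.1 t
    have e2 : HasDerivAt (fun s : ℝ => κ * (s + s ^ 2)) (κ * (1 + 2 * t)) t := by
      refine (((hasDerivAt_id' t).fun_add ((hasDerivAt_id' t).fun_pow 2)).const_mul κ).congr_deriv ?_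
      norm_num
    dsimp only
    exact (e1.add_const _).fun_add (e2.add_const _)
  have hg : HasFDerivAt (fun x => coupling A (t, x) q + penalty κ η (t, x))
      (∑ k, (2 * A * (x k - q.2 k) + η * (1 - (x k ^ 2)⁻¹)) •
        (ContinuousLinearMap.proj k : (ι → ℝ) →L[ℝ] ℝ)) x := by
    have e : ∀ k, HasFDerivAt
        (fun x : ι → ℝ => A * (x k - q.2 k) ^ 2 + η * (x k + (x k)⁻¹))
        ((2 * A * (x k - q.2 k) + η * (1 - (x k ^ 2)⁻¹)) •
        (ContinuousLinearMap.proj k : (ι → ℝ) →L[ℝ] ℝ)) x := by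
      intro k
      have e1 : HasDerivAt (fun r : ℝ => A * (r - q.2 k) ^ 2 + η * (r + r⁻¹))
          (2 * A * (x k - q.2 k) + η * (1 - (x k ^ 2)⁻¹)) (x k) := by
        have e3 := ((hasDerivAt_id' (x k)).fun_add (hasDerivAt_inv (hx k).ne')).const_mul η
        rw [← sub_eq_add_neg] at e3
        exact (hasDerivAt_mul_sub_sq A (q.2 k) (x k)).fun_add e3
      exact e1.comp_hasFDerivAt x (ContinuousLinearMap.proj k : (ι → ℝ) →L[ℝ] ℝ).hasFDerivAt
    have e4 := (HasFDerivAt.fun_sum (u := Finset.univ) fun k _ => e k).const_add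
      (A * (t - q.1) ^ 2 + κ * (t + t ^ 2))
    refine e4.congr_of_eventuallyEq (Eventually.of_forall fun y => ?_)
    simp only [coupling, penalty, Finset.sum_add_distrib]
    ring
  have hgrad : grad (fun x => coupling A (t, x) q + penalty κ η (t, x)) x ≤
      fun k => 2 * A * (x k - q.2 k) + η := by
    intro k
    rw [grad, hg.fderiv]
    have : 0 ≤ η * (x k ^ 2)⁻¹ := by positivity
    simp [Pi.single_apply]
    linarith
  have h2 := hmono _ _ hgrad
  rw [hd.deriv] at h1
  have h3 : 0 ≤ κ * t := by positivity
  simp only at h2 ⊢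
  linarith

theorem mul_sub_sq_le {A c r : ℝ} (hA : 0 < A) : c * r - A * r ^ 2 ≤ c ^ 2 / (4 * A) := by
  rw [le_div_iff₀ (by positivity)]
  nlinarith [sq_nonneg (2 * A * r - c)]

/-- Comparison for a subsolution `u` and the opposite `w` of a supersolution. No boundary condition
is needed: the barrier terms `η / x k` only decrease the gradient seen by each non-linearity. -/
theorem comparison [DecidableEq ι] {H : (ι → ℝ) → ℝ} (hmono : ∀ y y', y ≤ y' → H y ≤ H y')
    {W : ℝ} (hW : 0 ≤ W) (hlip : ∀ y y', |H y - H y'| ≤ W * ‖y - y'‖)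
    {u w : ℝ → (ι → ℝ) → ℝ} (hu : SubTest H u) (hw : SubTest (reflect H) w)
    (hcu : ContinuousOn (fun p : ℝ × (ι → ℝ) => u p.1 p.2) (Ici 0 ×ˢ openOrthant ι))
    (hcw : ContinuousOn (fun p : ℝ × (ι → ℝ) => w p.1 p.2) (Ici 0 ×ˢ openOrthant ι))
    {L C : ℝ} (hbound : ∀ p ∈ Ici 0 ×ˢ openOrthant ι, ∀ q ∈ Ici 0 ×ˢ openOrthant ι,
      u p.1 p.2 + w q.1 q.2 ≤ L * ∑ k, |p.2 k - q.2 k| + C * (p.1 + q.1)) :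
    ∀ p ∈ Ici 0 ×ˢ openOrthant ι, u p.1 p.2 + w p.1 p.2 ≤ 0 := by
  intro p₀ hp₀
  by_contra! hθ
  set θ := u p₀.1 p₀.2 + w p₀.1 p₀.2
  have ht₀ : 0 ≤ p₀.1 := hp₀.1
  have hx₀ : ∀ k, 0 < p₀.2 k := hp₀.2
  set d : ℝ := (Fintype.card ι : ℝ) with hd
  have hS₀ : 0 ≤ ∑ k, (p₀.2 k + (p₀.2 k)⁻¹) :=
    Finset.sum_nonneg fun k _ => by have := hx₀ k; positivity
  -- the parameters: `κ`, then `η` much smaller, and `A` large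
  obtain ⟨κ, hκ, hκθ⟩ : ∃ κ : ℝ, 0 < κ ∧ κ * (p₀.1 + p₀.1 ^ 2) ≤ θ / 8 := by
    refine ⟨θ / (8 * (p₀.1 + p₀.1 ^ 2 + 1)), by positivity, ?_⟩
    rw [div_mul_eq_mul_div, div_le_div_iff₀ (by positivity) (by norm_num)]
    nlinarith
  obtain ⟨η, hη, hηθ, hηκ⟩ : ∃ η : ℝ, 0 < η ∧ η * ∑ k, (p₀.2 k + (p₀.2 k)⁻¹) ≤ θ / 8 ∧
      W * η < κ := by
    refine ⟨min (θ / (8 * (∑ k, (p₀.2 k + (p₀.2 k)⁻¹) + 1))) (κ / (W + 1)),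
      lt_min (by positivity) (by positivity), ?_, ?_⟩
    · refine (mul_le_mul_of_nonneg_right (min_le_left _ _) hS₀).trans ?_
      rw [div_mul_eq_mul_div, div_le_div_iff₀ (by positivity) (by norm_num)]
      nlinarith
    · refine (mul_le_mul_of_nonneg_left (min_le_right _ _) hW).trans_lt ?_
      rw [mul_div_assoc', div_lt_iff₀ (by positivity)]
      nlinarith
  obtain ⟨A, hA, hAθ⟩ : ∃ A : ℝ, 0 < A ∧ (d * L ^ 2 + C ^ 2) / (4 * A) ≤ θ / 4 := by
    refine ⟨(d * L ^ 2 + C ^ 2 + 1) / θ, by positivity, ?_⟩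
    rw [div_le_div_iff₀ (by positivity) (by norm_num)]
    field_simp
    nlinarith
  set Ψ : (ℝ × (ι → ℝ)) × (ℝ × (ι → ℝ)) → ℝ := fun z =>
    u z.1.1 z.1.2 + w z.2.1 z.2.2 - coupling A z.1 z.2 - penalty κ η z.1 - penalty κ η z.2 with hΨ
  have hbase : θ / 2 ≤ Ψ (p₀, p₀) := by
    have h1 : coupling A p₀ p₀ = 0 := by simp [coupling]
    have h2 : penalty κ η p₀ ≤ θ / 4 := by
      rw [penalty, ← Finset.mul_sum]; linarith
    simp only [hΨ, h1]
    linarith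
  -- the spatial part of the coupling absorbs the Lipschitz bound
  have hspace : ∀ z : (ℝ × (ι → ℝ)) × (ℝ × (ι → ℝ)),
      L * ∑ k, |z.1.2 k - z.2.2 k| - ∑ k, A * (z.1.2 k - z.2.2 k) ^ 2 ≤ d * L ^ 2 / (4 * A) := by
    intro z
    rw [Finset.mul_sum, ← Finset.sum_sub_distrib]
    refine (Finset.sum_le_sum fun k _ => (?_ : _ ≤ L ^ 2 / (4 * A))).trans (le_of_eq ?_)
    · rw [← sq_abs (z.1.2 k - z.2.2 k)]
      exact mul_sub_sq_le hA
    · rw [Finset.sum_const, Finset.card_univ, nsmul_eq_mul, hd]; ring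
  have hpen : ∀ p ∈ Ici 0 ×ˢ openOrthant ι, 0 ≤ penalty κ η p := by
    rintro p ⟨hp1, hp2⟩
    have hp1 : 0 ≤ p.1 := hp1
    refine add_nonneg (by positivity) (Finset.sum_nonneg fun k _ => ?_)
    have := hp2 k
    positivity
  set E : ℝ := d * L ^ 2 / (4 * A) + C ^ 2 / (4 * κ) + C ^ 2 / (4 * κ) with hE
  -- superlevel sets of `Ψ` are bounded, and stay away from the boundary of the orthant
  have hcoer : ∀ p ∈ Ici 0 ×ˢ openOrthant ι, ∀ q ∈ Ici 0 ×ˢ openOrthant ι, 0 ≤ Ψ (p, q) →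
      (κ * p.1 + ∑ k, η * (p.2 k + (p.2 k)⁻¹)) + (κ * q.1 + ∑ k, η * (q.2 k + (q.2 k)⁻¹)) ≤ E := by
    intro p hp q hq hpq
    have h1 := hbound p hp q hq
    have h2 := hspace (p, q)
    have h3 := mul_sub_sq_le (c := C) (r := p.1) hκ
    have h4 := mul_sub_sq_le (c := C) (r := q.1) hκ
    have h5 : 0 ≤ A * (p.1 - q.1) ^ 2 := by positivity
    simp only [hΨ, coupling, penalty] at hpq
    simp only at h2
    linarith
  have hpart : ∀ p ∈ Ici 0 ×ˢ openOrthant ι, 0 ≤ κ * p.1 + ∑ k, η * (p.2 k + (p.2 k)⁻¹) := by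
    rintro p ⟨hp1, hp2⟩
    have hp1 : 0 ≤ p.1 := hp1
    refine add_nonneg (by positivity) (Finset.sum_nonneg fun k _ => ?_)
    have := hp2 k
    positivity
  set Q : Set (ℝ × (ι → ℝ)) :=
    Icc 0 (E / κ) ×ˢ Icc (fun _ => η / (E + 1)) (fun _ => E / η) with hQ
  have hE0 : 0 ≤ E := by
    have : 0 ≤ d := by positivity
    positivity
  have hQsub : Q ⊆ Ici 0 ×ˢ openOrthant ι := by
    rintro p ⟨hp1, hp2⟩
    refine ⟨hp1.1, fun k => lt_of_lt_of_le ?_ (hp2.1 k)⟩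
    positivity
  have hmemQ : ∀ p ∈ Ici 0 ×ˢ openOrthant ι,
      κ * p.1 + ∑ k, η * (p.2 k + (p.2 k)⁻¹) ≤ E → p ∈ Q := by
    rintro p ⟨hp1, hp2⟩ hpE
    have hp1 : 0 ≤ p.1 := hp1
    have hnn : ∀ k, 0 ≤ η * (p.2 k + (p.2 k)⁻¹) := fun k => by
      have := hp2 k
      positivity
    have hs := Finset.sum_nonneg fun k (_ : k ∈ Finset.univ) => hnn k
    have hk : ∀ k, η * (p.2 k + (p.2 k)⁻¹) ≤ E := fun k => by
      have h1 := Finset.single_le_sum (fun k _ => hnn k) (Finset.mem_univ k)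
      have : 0 ≤ κ * p.1 := by positivity
      linarith
    refine ⟨⟨hp1, ?_⟩, fun k => ?_, fun k => ?_⟩
    · rw [le_div_iff₀' hκ]; linarith
    · have h1 : 0 < p.2 k := hp2 k
      have h2 := hk k
      have h3 : 0 < η * p.2 k := by positivity
      have h4 : η * (p.2 k)⁻¹ ≤ E + 1 := by linarith
      rw [← div_eq_mul_inv, div_le_iff₀ h1] at h4
      rwa [div_le_iff₀' (by positivity)]
    · have h1 : 0 < p.2 k := hp2 k
      have h2 := hk k
      have h3 : 0 < η * (p.2 k)⁻¹ := by positivity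
      rw [le_div_iff₀' hη]
      linarith
  have hmemQQ : ∀ p ∈ Ici 0 ×ˢ openOrthant ι, ∀ q ∈ Ici 0 ×ˢ openOrthant ι, 0 ≤ Ψ (p, q) →
      (p, q) ∈ Q ×ˢ Q := by
    intro p hp q hq hpq
    have h1 := hcoer p hp q hq hpq
    have h2 := hpart p hp
    have h3 := hpart q hq
    exact ⟨hmemQ p hp (by linarith), hmemQ q hq (by linarith)⟩
  have hcompact : IsCompact (Q ×ˢ Q) :=
    (isCompact_Icc.prod isCompact_Icc).prod (isCompact_Icc.prod isCompact_Icc)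
  have hpenc : ContinuousOn (penalty κ η) (Ici 0 ×ˢ openOrthant ι) := by
    unfold penalty
    refine ContinuousOn.add (by fun_prop) (continuousOn_finsetSum _ fun k _ => ?_)
    have hk : ContinuousOn (fun p : ℝ × (ι → ℝ) => p.2 k) (Ici 0 ×ˢ openOrthant ι) := by fun_prop
    exact continuousOn_const.mul (hk.add (hk.inv₀ fun p hp => (hp.2 k).ne'))
  have hcont : ContinuousOn Ψ (Q ×ˢ Q) := by
    have m1 : MapsTo Prod.fst (Q ×ˢ Q) (Ici 0 ×ˢ openOrthant ι) := fun z hz => hQsub hz.1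
    have m2 : MapsTo Prod.snd (Q ×ˢ Q) (Ici 0 ×ˢ openOrthant ι) := fun z hz => hQsub hz.2
    have hcc : Continuous fun z : (ℝ × (ι → ℝ)) × (ℝ × (ι → ℝ)) => coupling A z.1 z.2 := by
      unfold coupling; fun_prop
    exact ((((hcu.comp continuousOn_fst m1).add (hcw.comp continuousOn_snd m2)).sub
      hcc.continuousOn).sub (hpenc.comp continuousOn_fst m1)).sub (hpenc.comp continuousOn_snd m2)
  have hbaseQ := hmemQQ p₀ hp₀ p₀ hp₀ (by linarith)
  obtain ⟨⟨p, q⟩, hpqQ, hmaxQ⟩ := hcompact.exists_isMaxOn ⟨_, hbaseQ⟩ hcont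
  have hmaxθ : θ / 2 ≤ Ψ (p, q) := hbase.trans (hmaxQ hbaseQ)
  have hmax : ∀ p' ∈ Ici 0 ×ˢ openOrthant ι, ∀ q' ∈ Ici 0 ×ˢ openOrthant ι,
      Ψ (p', q') ≤ Ψ (p, q) := by
    intro p' hp' q' hq'
    by_cases h : 0 ≤ Ψ (p', q')
    · exact hmaxQ (hmemQQ p' hp' q' hq' h)
    · linarith
  have hpD := hQsub hpqQ.1
  have hqD := hQsub hpqQ.2
  -- the maximum is not attained at time zero
  have hzero : p.1 ≠ 0 ∧ q.1 ≠ 0 := by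
    have h1 := hbound p hpD q hqD
    have h2 := hspace (p, q)
    have h3 := hpen p hpD
    have h4 := hpen q hqD
    simp only [hΨ, coupling] at hmaxθ
    simp only at h2
    rw [add_div] at hAθ
    constructor
    · intro h0
      have h5 := mul_sub_sq_le (c := C) (r := q.1) hA
      rw [h0] at hmaxθ h1
      simp only [zero_sub, neg_sq, zero_add] at hmaxθ h1
      linarith
    · intro h0
      have h5 := mul_sub_sq_le (c := C) (r := p.1) hA
      rw [h0] at hmaxθ h1
      simp only [sub_zero, add_zero] at hmaxθ h1
      linarith
  have hp0 : 0 < p.1 := lt_of_le_of_ne hpD.1 hzero.1.symm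
  have hq0 : 0 < q.1 := lt_of_le_of_ne hqD.1 hzero.2.symm
  have hsub : Ioi (0 : ℝ) ×ˢ openOrthant ι ⊆ Ici 0 ×ˢ openOrthant ι :=
    prod_mono Ioi_subset_Ici_self subset_rfl
  have hup := hu.le_of_isLocalMaxOn hmono hκ.le hη.le (A := A) (p := p) (q := q) ⟨hp0, hpD.2⟩ (by
    refine eventually_of_mem self_mem_nhdsWithin fun p' hp' => ?_
    have := hmax p' (hsub hp') q hqD
    simp only [hΨ] at this
    show u p'.1 p'.2 - _ ≤ u p.1 p.2 - _
    linarith)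
  have hrmono : ∀ y y', y ≤ y' → reflect H y ≤ reflect H y' := fun y y' hyy' =>
    neg_le_neg (hmono _ _ (neg_le_neg hyy'))
  have hwq := hw.le_of_isLocalMaxOn hrmono hκ.le hη.le (A := A) (p := q) (q := p) ⟨hq0, hqD.2⟩ (by
    refine eventually_of_mem self_mem_nhdsWithin fun q' hq' => ?_
    have := hmax p hpD q' (hsub hq')
    simp only [hΨ] at this
    rw [coupling_comm A p q', coupling_comm A p q] at this
    show w q'.1 q'.2 - _ ≤ w q.1 q.2 - _
    linarith)
  rw [reflect] at hwq
  have hfin := (abs_le.1 (hlip (fun k => 2 * A * (p.2 k - q.2 k) + η)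
    (-fun k => 2 * A * (q.2 k - p.2 k) + η))).2
  have hnorm : ‖(fun k => 2 * A * (p.2 k - q.2 k) + η) - (-fun k => 2 * A * (q.2 k - p.2 k) + η)‖
      ≤ 2 * η := by
    refine (pi_norm_le_iff_of_nonneg (by positivity)).2 fun k => ?_
    simp only [Pi.sub_apply, Pi.neg_apply]
    rw [show 2 * A * (p.2 k - q.2 k) + η - -(2 * A * (q.2 k - p.2 k) + η) = 2 * η by ring,
      Real.norm_of_nonneg (by positivity)]
  have := mul_le_mul_of_nonneg_left hnorm hW
  linarith

end Comparison

/-! ### The upwind scheme -/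

section Scheme

variable {ι : Type*} [Fintype ι] [DecidableEq ι]

/-- One step of the explicit upwind scheme, with time step `h` and space step `ε`: the gradient is
replaced by forward differences, so that the scheme never leaves the orthant. -/
noncomputable def upwindStep (H : (ι → ℝ) → ℝ) (h ε : ℝ) (u : (ι → ℝ) → ℝ) (x : ι → ℝ) : ℝ :=
  u x + h * H (fun k => (u (x + Pi.single k ε) - u x) / ε)

omit [Fintype ι] in
theorem add_single_mem_orthant {x : ι → ℝ} (hx : x ∈ orthant ι) {ε : ℝ} (hε : 0 ≤ ε) (k : ι) :
    x + Pi.single k ε ∈ orthant ι :=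
  add_nonneg (a := x) hx (Pi.single_nonneg.2 hε)

variable {H : (ι → ℝ) → ℝ} {W h ε : ℝ}

/-- Under the stability condition `h W ≤ ε`, the scheme is monotone, and it commutes with
translations and with the addition of constants. -/
theorem upwindStep_le (hmono : ∀ y y', y ≤ y' → H y ≤ H y')
    (hlip : ∀ y y', |H y - H y'| ≤ W * ‖y - y'‖) (hW0 : 0 ≤ W) (hh : 0 ≤ h) (hε : 0 < ε)
    (hW : h * W ≤ ε)
    {u v : (ι → ℝ) → ℝ} {x y : ι → ℝ} {c : ℝ} (h0 : u x ≤ v y + c)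
    (hk : ∀ k, u (x + Pi.single k ε) ≤ v (y + Pi.single k ε) + c) :
    upwindStep H h ε u x ≤ upwindStep H h ε v y + c := by
  set D := v y + c - u x with hD
  have hD0 : 0 ≤ D := by simp only [hD]; linarith
  set b : ι → ℝ := fun k => (v (y + Pi.single k ε) - v y) / ε with hb
  have h1 : H (fun k => (u (x + Pi.single k ε) - u x) / ε) ≤ H (b + fun _ => D / ε) := by
    refine hmono _ _ fun k => ?_
    simp only [hb, Pi.add_apply]
    rw [← add_div]
    have := hk k
    gcongr
    simp only [hD]
    linarith
  have h2 := (abs_le.1 (hlip (b + fun _ => D / ε) b)).2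
  have h3 : ‖b + (fun _ => D / ε) - b‖ ≤ D / ε := by
    rw [add_sub_cancel_left]
    refine (pi_norm_le_iff_of_nonneg (by positivity)).2 fun k => ?_
    rw [Real.norm_of_nonneg (by positivity)]
  have h4 : h * (H (b + fun _ => D / ε) - H b) ≤ D := by
    calc h * (H (b + fun _ => D / ε) - H b) ≤ h * (W * (D / ε)) := by
          gcongr
          exact h2.trans (mul_le_mul_of_nonneg_left h3 hW0)
      _ = h * W * (D / ε) := by ring
      _ ≤ ε * (D / ε) := by gcongr
      _ = D := by field_simp
  have h5 := mul_le_mul_of_nonneg_left h1 hh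
  simp only [upwindStep]
  rw [mul_sub] at h4
  linarith

omit [Fintype ι] in
theorem upwindStep_reflect (u : (ι → ℝ) → ℝ) :
    upwindStep (reflect H) h ε (-u) = -upwindStep H h ε u := by
  ext x
  have : (-fun k => ((-u) (x + Pi.single k ε) - (-u) x) / ε) =
      fun k => (u (x + Pi.single k ε) - u x) / ε := by
    ext k
    simp only [Pi.neg_apply]
    ring
  rw [upwindStep, reflect, this, Pi.neg_apply, Pi.neg_apply, upwindStep]
  ring

omit [Fintype ι] in
theorem upwindStep_iterate_reflect (u : (ι → ℝ) → ℝ) (n : ℕ) :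
    (upwindStep (reflect H) h ε)^[n] (-u) = -(upwindStep H h ε)^[n] u := by
  induction n with
  | zero => rfl
  | succ n ih => rw [Function.iterate_succ_apply', ih, upwindStep_reflect,
      Function.iterate_succ_apply']

/-- The scheme preserves bounds on increments, for `z` of any sign: forward differences taken at `x`
and at `x + z` only involve points of the orthant. -/
theorem IncrementLE.upwindStep_iterate (hmono : ∀ y y', y ≤ y' → H y ≤ H y')
    (hlip : ∀ y y', |H y - H y'| ≤ W * ‖y - y'‖) (hW0 : 0 ≤ W) (hh : 0 ≤ h) (hε : 0 < ε)
    (hW : h * W ≤ ε)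
    {u : (ι → ℝ) → ℝ} {z : ι → ℝ} {c : ℝ} (hu : IncrementLE u z c) (n : ℕ) :
    IncrementLE ((upwindStep H h ε)^[n] u) z c := by
  induction n with
  | zero => exact hu
  | succ n ih =>
    rw [Function.iterate_succ_apply']
    intro x hx hxz
    refine upwindStep_le hmono hlip hW0 hh hε hW (ih x hx hxz) fun k => ?_
    have h1 := add_single_mem_orthant hxz hε.le k
    rw [add_right_comm] at h1 ⊢
    exact ih _ (add_single_mem_orthant hx hε.le k) h1

/-- Comparison of the scheme with a strict discrete supersolution `v`, on sets `B l` that shrink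
along the domain of dependence. -/
theorem upwindStep_iterate_le (hmono : ∀ y y', y ≤ y' → H y ≤ H y')
    (hlip : ∀ y y', |H y - H y'| ≤ W * ‖y - y'‖) (hW0 : 0 ≤ W) (hh : 0 ≤ h) (hε : 0 < ε)
    (hW : h * W ≤ ε)
    {u : (ι → ℝ) → ℝ} {v : ℕ → (ι → ℝ) → ℝ} {B : ℕ → Set (ι → ℝ)} {n : ℕ} {b c : ℝ}
    (hB : ∀ l < n, ∀ x ∈ B (l + 1), x ∈ B l ∧ ∀ k, x + Pi.single k ε ∈ B l)
    (hv : ∀ l < n, ∀ x ∈ B (l + 1), upwindStep H h ε (v l) x + b ≤ v (l + 1) x)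
    (h0 : ∀ x ∈ B 0, u x ≤ v 0 x + c) {l : ℕ} (hl : l ≤ n) :
    ∀ x ∈ B l, (upwindStep H h ε)^[l] u x ≤ v l x + (c - l * b) := by
  induction l with
  | zero => simpa using h0
  | succ l ih =>
    intro x hx
    rw [Function.iterate_succ_apply']
    obtain ⟨h1, h2⟩ := hB l hl x hx
    have ih := ih (by omega)
    have h3 := upwindStep_le hmono hlip hW0 hh hε hW (ih x h1) fun k => ih _ (h2 k)
    have h4 := hv l hl x hx
    push_cast
    linarith

theorem sum_abs_single (k : ι) (c : ℝ) : ∑ i, |(Pi.single k c : ι → ℝ) i| = |c| := by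
  rw [Finset.sum_eq_single k]
  · simp
  · intro i _ hi; simp [hi]
  · simp

theorem abs_upwindStep_iterate_sub_le (hmono : ∀ y y', y ≤ y' → H y ≤ H y')
    (hlip : ∀ y y', |H y - H y'| ≤ W * ‖y - y'‖) (hW0 : 0 ≤ W) (hh : 0 ≤ h) (hε : 0 < ε)
    (hW : h * W ≤ ε) {u : (ι → ℝ) → ℝ} {L : ℝ} (hL : 0 ≤ L)
    (hu : ∀ z, IncrementLE u z (L * ∑ k, |z k|)) (m n : ℕ) {x : ι → ℝ} (hx : x ∈ orthant ι) :
    |(upwindStep H h ε)^[m + n] u x - (upwindStep H h ε)^[m] u x| ≤ n * (h * (|H 0| + W * L)) := by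
  induction n with
  | zero => simp
  | succ n ih =>
    set v := (upwindStep H h ε)^[m + n] u with hv
    have hvL : ∀ z, IncrementLE v z (L * ∑ k, |z k|) := fun z =>
      (hu z).upwindStep_iterate hmono hlip hW0 hh hε hW _
    have hstep : |(upwindStep H h ε)^[m + (n + 1)] u x - v x| ≤ h * (|H 0| + W * L) := by
      rw [← add_assoc, Function.iterate_succ_apply', ← hv, upwindStep, add_sub_cancel_left, abs_mul,
        abs_of_nonneg hh]
      refine mul_le_mul_of_nonneg_left ?_ hh
      set p : ι → ℝ := fun k => (v (x + Pi.single k ε) - v x) / ε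
      have hp : ‖p‖ ≤ L := by
        refine (pi_norm_le_iff_of_nonneg hL).2 fun k => ?_
        have hxk := add_single_mem_orthant hx hε.le k
        have h1 := hvL (Pi.single k ε) x hx hxk
        have h2 := hvL (-Pi.single k ε) (x + Pi.single k ε) hxk (by simpa using hx)
        simp only [Pi.neg_apply, abs_neg, sum_abs_single, abs_of_pos hε,
          add_neg_cancel_right] at h1 h2
        rw [Real.norm_eq_abs, abs_div, abs_of_pos hε, div_le_iff₀ hε, abs_le]
        constructor <;> linarith
      have h3 := hlip p 0
      rw [sub_zero] at h3
      have h4 := mul_le_mul_of_nonneg_left hp hW0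
      have h5 := abs_sub_abs_le_abs_sub (H p) (H 0)
      linarith
    calc _ = |((upwindStep H h ε)^[m + (n + 1)] u x - v x) +
          (v x - (upwindStep H h ε)^[m] u x)| := by congr 1; ring
      _ ≤ _ := abs_add_le _ _
      _ ≤ h * (|H 0| + W * L) + n * (h * (|H 0| + W * L)) := add_le_add hstep ih
      _ = _ := by push_cast; ring

end Scheme

/-! ### Existence, as a limit of the scheme -/

section Existence

variable {ι : Type*} [Fintype ι] [DecidableEq ι]

/-- The approximate solution with time step `2⁻ʲ` and space step `W 2⁻ʲ`, constant on each time
interval. Here `W` bounds the Lipschitz constant of the non-linearity. -/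
noncomputable def upwindApprox (H : (ι → ℝ) → ℝ) (W : ℝ) (ψ : (ι → ℝ) → ℝ) (j : ℕ) (t : ℝ) :
    (ι → ℝ) → ℝ :=
  (upwindStep H ((1 / 2) ^ j) (W * (1 / 2) ^ j))^[⌊t * 2 ^ j⌋₊] ψ

/-- `f` is the limit of the approximate solutions along a fixed non-principal ultrafilter. -/
def IsUpwindLimit (H : (ι → ℝ) → ℝ) (W : ℝ) (ψ : (ι → ℝ) → ℝ) (f : ℝ → (ι → ℝ) → ℝ) : Prop :=
  ∀ t ∈ Ici (0 : ℝ), ∀ x ∈ orthant ι,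
    Tendsto (fun j => upwindApprox H W ψ j t x) (hyperfilter ℕ) (𝓝 (f t x))

variable {H : (ι → ℝ) → ℝ} {W : ℝ} {ψ : (ι → ℝ) → ℝ} {f : ℝ → (ι → ℝ) → ℝ}

omit [Fintype ι] in
theorem IsUpwindLimit.reflect (hf : IsUpwindLimit H W ψ f) :
    IsUpwindLimit (reflect H) W (-ψ) (fun t x => -f t x) := by
  intro t ht x hx
  simp only [upwindApprox, upwindStep_iterate_reflect]
  exact (hf t ht x hx).neg

omit [Fintype ι] in
theorem IsUpwindLimit.initial (hf : IsUpwindLimit H W ψ f) {x : ι → ℝ} (hx : x ∈ orthant ι) :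
    f 0 x = ψ x := by
  refine tendsto_nhds_unique (hf 0 self_mem_Ici x hx) ?_
  simp [upwindApprox]

theorem incrementLE_upwindApprox (hmono : ∀ y y', y ≤ y' → H y ≤ H y')
    (hlip : ∀ y y', |H y - H y'| ≤ W * ‖y - y'‖) (hW : 0 < W) {z : ι → ℝ} {c : ℝ}
    (hψ : IncrementLE ψ z c) (j : ℕ) (t : ℝ) : IncrementLE (upwindApprox H W ψ j t) z c :=
  hψ.upwindStep_iterate hmono hlip hW.le (by positivity) (by positivity) (by rw [mul_comm]) _

theorem IsUpwindLimit.incrementLE (hf : IsUpwindLimit H W ψ f)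
    (hmono : ∀ y y', y ≤ y' → H y ≤ H y')
    (hlip : ∀ y y', |H y - H y'| ≤ W * ‖y - y'‖) (hW : 0 < W) {z : ι → ℝ} {c : ℝ}
    (hψ : IncrementLE ψ z c) {t : ℝ} (ht : 0 ≤ t) : IncrementLE (f t) z c := by
  intro x hx hxz
  exact le_of_tendsto_of_tendsto' (hf t ht _ hxz) ((hf t ht _ hx).add_const c)
    fun j => incrementLE_upwindApprox hmono hlip hW hψ j t x hx hxz

theorem abs_upwindApprox_sub_le (hmono : ∀ y y', y ≤ y' → H y ≤ H y')
    (hlip : ∀ y y', |H y - H y'| ≤ W * ‖y - y'‖) (hW : 0 < W) {L : ℝ} (hL : 0 ≤ L)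
    (hψ : ∀ z, IncrementLE ψ z (L * ∑ k, |z k|)) {s t : ℝ} (hs : 0 ≤ s) (hst : s ≤ t) (j : ℕ)
    {x : ι → ℝ} (hx : x ∈ orthant ι) :
    |upwindApprox H W ψ j t x - upwindApprox H W ψ j s x| ≤
      (t - s + (1 / 2) ^ j) * (|H 0| + W * L) := by
  have hfl : ⌊s * 2 ^ j⌋₊ ≤ ⌊t * 2 ^ j⌋₊ := Nat.floor_mono (by gcongr)
  obtain ⟨n, hn⟩ := Nat.exists_eq_add_of_le hfl
  rw [upwindApprox, upwindApprox, hn]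
  refine (abs_upwindStep_iterate_sub_le hmono hlip hW.le (by positivity) (by positivity)
    (by rw [mul_comm]) hL hψ _ n hx).trans ?_
  rw [← mul_assoc]
  refine mul_le_mul_of_nonneg_right ?_ (by positivity)
  have h1 : (⌊t * 2 ^ j⌋₊ : ℝ) ≤ t * 2 ^ j := Nat.floor_le (by have := hs.trans hst; positivity)
  have h2 : s * 2 ^ j < ⌊s * 2 ^ j⌋₊ + 1 := Nat.lt_floor_add_one _
  rw [hn] at h1
  push_cast at h1
  have h3 : (n : ℝ) ≤ (t - s) * 2 ^ j + 1 := by linarith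
  calc (n : ℝ) * (1 / 2) ^ j ≤ ((t - s) * 2 ^ j + 1) * (1 / 2) ^ j := by gcongr
    _ = (t - s) * (2 ^ j * (1 / 2) ^ j) + (1 / 2) ^ j := by ring
    _ = _ := by rw [← mul_pow]; norm_num

theorem IsUpwindLimit.abs_sub_le (hf : IsUpwindLimit H W ψ f)
    (hmono : ∀ y y', y ≤ y' → H y ≤ H y')
    (hlip : ∀ y y', |H y - H y'| ≤ W * ‖y - y'‖) (hW : 0 < W) {L : ℝ} (hL : 0 ≤ L)
    (hψ : ∀ z, IncrementLE ψ z (L * ∑ k, |z k|)) {s t : ℝ} (hs : 0 ≤ s) (ht : 0 ≤ t)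
    {x : ι → ℝ} (hx : x ∈ orthant ι) : |f t x - f s x| ≤ |t - s| * (|H 0| + W * L) := by
  wlog hst : s ≤ t generalizing s t
  · rw [abs_sub_comm, abs_sub_comm t]
    exact this ht hs (le_of_not_ge hst)
  rw [abs_of_nonneg (sub_nonneg.2 hst)]
  have h1 : Tendsto (fun j : ℕ => ((1 : ℝ) / 2) ^ j) (hyperfilter ℕ) (𝓝 0) :=
    (tendsto_pow_atTop_nhds_zero_of_lt_one (by norm_num) (by norm_num)).mono_left
      Nat.hyperfilter_le_atTop
  have h2 := (h1.const_add (t - s)).mul_const (|H 0| + W * L)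
  rw [add_zero] at h2
  exact le_of_tendsto_of_tendsto' ((hf t ht x hx).sub (hf s hs x hx)).abs h2
    fun j => abs_upwindApprox_sub_le hmono hlip hW hL hψ hs hst j hx

/-- At each point the approximations are bounded, hence converge along the ultrafilter. -/
theorem exists_isUpwindLimit (hmono : ∀ y y', y ≤ y' → H y ≤ H y')
    (hlip : ∀ y y', |H y - H y'| ≤ W * ‖y - y'‖) (hW : 0 < W) {L : ℝ} (hL : 0 ≤ L)
    (hψ : ∀ z, IncrementLE ψ z (L * ∑ k, |z k|)) : ∃ f, IsUpwindLimit H W ψ f := by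
  refine ⟨fun t x => limUnder (hyperfilter ℕ : Filter ℕ) fun j => upwindApprox H W ψ j t x,
    fun t ht x hx => tendsto_nhds_limUnder ?_⟩
  set M := (t + 1) * (|H 0| + W * L)
  have hb : ∀ j, upwindApprox H W ψ j t x ∈ Icc (ψ x - M) (ψ x + M) := by
    intro j
    have h1 := abs_upwindApprox_sub_le hmono hlip hW hL hψ le_rfl ht j hx
    have h2 : upwindApprox H W ψ j 0 x = ψ x := by simp [upwindApprox]
    have h3 : (t - 0 + (1 / 2) ^ j) * (|H 0| + W * L) ≤ M := by
      rw [sub_zero]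
      refine mul_le_mul_of_nonneg_right ?_ (by positivity)
      have : ((1 : ℝ) / 2) ^ j ≤ 1 := pow_le_one₀ (by norm_num) (by norm_num)
      linarith
    rw [h2] at h1
    have h4 := abs_le.1 (h1.trans h3)
    exact ⟨by linarith [h4.1], by linarith [h4.2]⟩
  obtain ⟨r, -, hr⟩ := isCompact_Icc.ultrafilter_le_nhds
    ((hyperfilter ℕ).map fun j => upwindApprox H W ψ j t x)
    (le_principal_iff.2 (Eventually.of_forall hb : ∀ᶠ j in (hyperfilter ℕ : Filter ℕ), _))
  exact ⟨r, hr⟩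

omit [DecidableEq ι] in
/-- Pointwise convergence of uniformly Lipschitz functions is uniform on compact sets. -/
theorem eventually_forall_le_add {α : Type*} {l : Filter α} {u : α → (ι → ℝ) → ℝ}
    {v : (ι → ℝ) → ℝ} {L : ℝ} (hL : 0 ≤ L) (hu : ∀ j z, IncrementLE (u j) z (L * ∑ k, |z k|))
    (hv : ∀ z, IncrementLE v z (L * ∑ k, |z k|))
    (hlim : ∀ x ∈ orthant ι, Tendsto (fun j => u j x) l (𝓝 (v x))) {S : Set (ι → ℝ)}
    (hS : IsCompact S) (hSo : S ⊆ orthant ι) {ρ : ℝ} (hρ : 0 < ρ) :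
    ∀ᶠ j in l, ∀ x ∈ S, u j x ≤ v x + ρ := by
  have hsum : ∀ z : ι → ℝ, L * ∑ k, |z k| ≤ L * (Fintype.card ι * ‖z‖) := by
    intro z
    refine mul_le_mul_of_nonneg_left ?_ hL
    refine (Finset.sum_le_card_nsmul _ _ ‖z‖ fun k _ => norm_le_pi_norm z k).trans (le_of_eq ?_)
    rw [nsmul_eq_mul, Finset.card_univ]
  set e : ℝ := ρ / (3 * (L * Fintype.card ι + 1)) with he
  have he0 : 0 < e := by positivity
  have hLe : L * (Fintype.card ι * e) ≤ ρ / 3 := by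
    rw [he, ← mul_assoc, mul_div_assoc', div_le_div_iff₀ (by positivity) (by norm_num)]
    nlinarith
  obtain ⟨T, hTS, hTfin, hcover⟩ := hS.finite_cover_balls he0
  have hev : ∀ᶠ j in l, ∀ y ∈ T, u j y < v y + ρ / 3 :=
    (eventually_all_finite hTfin).2 fun y hy =>
      (hlim y (hSo (hTS hy))).eventually_lt_const (by linarith)
  refine hev.mono fun j hj x hx => ?_
  obtain ⟨y, hy, hxy⟩ := mem_iUnion₂.1 (hcover hx)
  have hyo := hSo (hTS hy)
  have hxo := hSo hx
  rw [Metric.mem_ball, dist_eq_norm] at hxy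
  have h1 := hu j (x - y) y hyo (by simpa using hxo)
  have h2 := hv (y - x) x hxo (by simpa using hyo)
  have h3 := hsum (x - y)
  have h4 := hsum (y - x)
  have h5 : L * (Fintype.card ι * ‖x - y‖) ≤ L * (Fintype.card ι * e) := by gcongr
  rw [norm_sub_rev] at h4
  rw [add_sub_cancel] at h1 h2
  have h6 := hj y hy
  linarith

/-- If `φ` touches the limit `f` from above with `∂ₜ φ > H (∇ φ)`, then `φ` is a strict discrete
supersolution near the contact point; comparing it with the scheme on the domain of dependence of
this point pushes `f` strictly below `φ` there. -/
theorem IsUpwindLimit.subTest (hf : IsUpwindLimit H W ψ f) (hmono : ∀ y y', y ≤ y' → H y ≤ H y')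
    (hlip : ∀ y y', |H y - H y'| ≤ W * ‖y - y'‖) (hW : 0 < W) {L : ℝ} (hL : 0 ≤ L)
    (hψ : ∀ z, IncrementLE ψ z (L * ∑ k, |z k|)) : SubTest H f := by
  intro φ hφ t₀ ht₀ x₀ hx₀ hmax
  by_contra! hγ
  set γ := deriv (fun s => φ s x₀) t₀ - H (grad (φ t₀) x₀) with hγdef
  have hopen : IsOpen (Ioi (0 : ℝ) ×ˢ openOrthant ι) := isOpen_Ioi.prod isOpen_openOrthant
  have hmem : (t₀, x₀) ∈ Ioi (0 : ℝ) ×ˢ openOrthant ι := ⟨ht₀, hx₀⟩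
  have hstrict := (hφ.contDiffAt (hopen.mem_nhds hmem)).hasStrictFDerivAt (by simp)
  set Φ' := fderiv ℝ (fun p : ℝ × (ι → ℝ) => φ p.1 p.2) (t₀, x₀)
  have hdt : deriv (fun s => φ s x₀) t₀ = Φ' (1, 0) := by
    have h1 : HasDerivAt (fun s : ℝ => (s, x₀)) (1, 0) t₀ :=
      (hasDerivAt_id' t₀).prodMk (hasDerivAt_const t₀ x₀)
    exact (hstrict.hasFDerivAt.comp_hasDerivAt t₀ h1).deriv
  have hdx : ∀ k, grad (φ t₀) x₀ k = Φ' (0, Pi.single k 1) := by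
    intro k
    have h1 : HasFDerivAt (fun x : ι → ℝ => (t₀, x)) (ContinuousLinearMap.inr ℝ ℝ (ι → ℝ)) x₀ :=
      hasFDerivAt_prodMk_right t₀ x₀
    have h2 : HasFDerivAt (φ t₀) (Φ'.comp (ContinuousLinearMap.inr ℝ ℝ (ι → ℝ))) x₀ :=
      HasFDerivAt.comp x₀ hstrict.hasFDerivAt h1
    rw [grad, h2.fderiv]
    simp
  set c : ℝ := γ / (2 * (1 + W)) with hc
  have hc0 : 0 < c := by positivity
  have hloc : ∀ᶠ p in 𝓝 (t₀, x₀), p ∈ Ioi (0 : ℝ) ×ˢ openOrthant ι ∧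
      f p.1 p.2 - φ p.1 p.2 ≤ f t₀ x₀ - φ t₀ x₀ := by
    have h1 := hmax
    rw [IsLocalMaxOn, IsMaxFilter, hopen.nhdsWithin_eq hmem] at h1
    exact (hopen.eventually_mem hmem).and h1
  have hdiff : ∀ᶠ z in 𝓝 ((t₀, x₀), (t₀, x₀)),
      |φ z.1.1 z.1.2 - φ z.2.1 z.2.2 - Φ' (z.1 - z.2)| ≤ c * ‖z.1 - z.2‖ :=
    hstrict.isLittleO.bound hc0
  obtain ⟨r₁, hr₁, hball₁⟩ := Metric.eventually_nhds_iff_ball.1 hloc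
  obtain ⟨r₂, hr₂, hball₂⟩ := Metric.eventually_nhds_iff_ball.1 hdiff
  set r := min r₁ r₂
  have hr : 0 < r := lt_min hr₁ hr₂
  -- a dyadic time step back from `t₀`, with its domain of dependence inside the ball
  obtain ⟨i, hi⟩ : ∃ i : ℕ, ((1 : ℝ) / 2) ^ i < r / (1 + W) :=
    exists_pow_lt_of_lt_one (by positivity) (by norm_num)
  set s : ℝ := (1 / 2) ^ i with hs
  have hs0 : 0 < s := by positivity
  have hsr : s * (1 + W) < r := by rwa [lt_div_iff₀ (by positivity)] at hi
  have hnear : ∀ (t : ℝ) (x : ι → ℝ), t₀ - s ≤ t → t ≤ t₀ → x₀ ≤ x →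
      (∀ k, x k ≤ x₀ k + s * W) → dist (t, x) (t₀, x₀) < r := by
    intro t x h1 h2 h3 h4
    refine lt_of_le_of_lt ?_ hsr
    have h5 : 0 < s * W := by positivity
    rw [Prod.dist_eq, max_le_iff, Real.dist_eq, abs_le]
    refine ⟨⟨by linarith, by linarith⟩, (dist_pi_le_iff (by positivity)).2 fun k => ?_⟩
    rw [Real.dist_eq, abs_le]
    have := h3 k
    have := h4 k
    constructor <;> linarith
  have hts : 0 < t₀ - s := by
    have h1 := (hball₁ _ ((hnear (t₀ - s) x₀ le_rfl (by linarith) le_rfl fun k => by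
      have : 0 < s * W := by positivity
      linarith).trans_le (min_le_left _ _))).1
    exact h1.1
  set S : Set (ι → ℝ) := Icc x₀ (fun k => x₀ k + s * W)
  have hSo : S ⊆ orthant ι := fun x hx k => (hx₀ k).le.trans (hx.1 k)
  have hunif := eventually_forall_le_add (l := (hyperfilter ℕ : Filter ℕ)) hL
    (fun j z => incrementLE_upwindApprox hmono hlip hW (hψ z) j (t₀ - s))
    (fun z => hf.incrementLE hmono hlip hW (hψ z) hts.le) (hf (t₀ - s) hts.le)
    (S := S) isCompact_Icc hSo (ρ := s * γ / 4) (by positivity)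
  have hlarge : ∀ᶠ j in (hyperfilter ℕ : Filter ℕ), i ≤ j :=
    Nat.hyperfilter_le_atTop (eventually_ge_atTop i)
  have hkey : ∀ᶠ j in (hyperfilter ℕ : Filter ℕ),
      upwindApprox H W ψ j t₀ x₀ ≤ f t₀ x₀ - s * γ / 4 := by
    filter_upwards [hunif, hlarge] with j hj hij
    obtain ⟨m, rfl⟩ := Nat.exists_eq_add_of_le hij
    set h : ℝ := (1 / 2) ^ (i + m) with hh
    have hh0 : 0 < h := by positivity
    set n : ℕ := 2 ^ m with hn
    have hnh : n * h = s := by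
      rw [hh, hs, hn, pow_add, mul_left_comm]
      push_cast
      rw [← mul_pow]
      norm_num
    have hε0 : 0 < W * h := by positivity
    have hfloor : ⌊t₀ * 2 ^ (i + m)⌋₊ = n + ⌊(t₀ - s) * 2 ^ (i + m)⌋₊ := by
      have h1 : t₀ * 2 ^ (i + m) = (t₀ - s) * 2 ^ (i + m) + n := by
        have : s * 2 ^ (i + m) = n := by
          rw [hs, hn, pow_add, ← mul_assoc, ← mul_pow]
          norm_num
        linarith
      rw [h1, Nat.floor_add_natCast (by positivity), add_comm]
    have hlh : ∀ l : ℕ, l ≤ n → (l : ℝ) * h ≤ s := fun l hl => by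
      rw [← hnh]; gcongr
    set B : ℕ → Set (ι → ℝ) := fun l => {x | x₀ ≤ x ∧ ∀ k, x k ≤ x₀ k + (s - l * h) * W} with hBdef
    have hB : ∀ l < n, ∀ x ∈ B (l + 1), x ∈ B l ∧ ∀ k, x + Pi.single k (W * h) ∈ B l := by
      rintro l - x ⟨h1, h2⟩
      push_cast at h2
      refine ⟨⟨h1, fun k => (h2 k).trans ?_⟩, fun k => ⟨fun k' => ?_, fun k' => ?_⟩⟩
      · nlinarith
      · exact (h1.trans (le_add_of_nonneg_right (Pi.single_nonneg.2 hε0.le))) k'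
      · have h3 : (Pi.single k (W * h) : ι → ℝ) k' ≤ W * h := by
          by_cases hk : k' = k
          · subst hk; simp
          · simp [hk, hε0.le]
        have h4 := h2 k'
        simp only [Pi.add_apply]
        linarith
    have hBr : ∀ l ≤ n, ∀ x ∈ B l, ∀ t, t₀ - s ≤ t → t ≤ t₀ → dist (t, x) (t₀, x₀) < r := by
      rintro l hl x ⟨h1, h2⟩ t h3 h4
      refine hnear t x h3 h4 h1 fun k => (h2 k).trans ?_
      have : 0 ≤ l * h * W := by positivity
      linarith
    -- consistency of the scheme along the test function
    have hv : ∀ l < n, ∀ x ∈ B (l + 1),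
        upwindStep H h (W * h) (φ (t₀ - s + (l : ℕ) * h)) x + h * (γ / 2) ≤
          φ (t₀ - s + (l + 1 : ℕ) * h) x := by
      intro l hl x hx
      set t := t₀ - s + (l : ℕ) * h
      have ht1 : t₀ - s + (l + 1 : ℕ) * h = t + h := by push_cast; ring
      rw [ht1]
      have hlt := hlh (l + 1) hl
      push_cast at hlt
      have htl : t₀ - s ≤ t := le_add_of_nonneg_right (by positivity)
      have htu : t + h ≤ t₀ := by
        show t₀ - s + l * h + h ≤ t₀
        linarith
      obtain ⟨hx0, hxk⟩ := hB l hl x hx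
      have d0 := hBr l hl.le x hx0 t htl (by linarith)
      have d1 := hBr l hl.le x hx0 (t + h) (by linarith) htu
      have d2 := fun k => hBr l hl.le _ (hxk k) t htl (by linarith)
      have e1 := hball₂ ((t + h, x), (t, x)) (by
        rw [Metric.mem_ball, Prod.dist_eq]
        exact (max_lt d1 d0).trans_le (min_le_right _ _))
      have e2 := fun k => hball₂ ((t, x + Pi.single k (W * h)), (t, x)) (by
        rw [Metric.mem_ball, Prod.dist_eq]
        exact (max_lt (d2 k) d0).trans_le (min_le_right _ _))
      have s1 : ((t + h, x) : ℝ × (ι → ℝ)) - (t, x) = h • (1, 0) := by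
        ext <;> simp
      have s2 : ∀ k, ((t, x + Pi.single k (W * h)) : ℝ × (ι → ℝ)) - (t, x) =
          (W * h) • (0, Pi.single k 1) := by
        intro k
        refine Prod.ext (by simp) ?_
        simp only [Prod.mk_sub_mk, add_sub_cancel_left, Prod.smul_mk]
        rw [← Pi.single_smul]; simp
      simp only [s1, s2, map_smul, norm_smul, smul_eq_mul, ← hdt, ← hdx, Prod.norm_mk, norm_zero,
        Pi.norm_single, norm_one, Real.norm_of_nonneg hh0.le, Real.norm_of_nonneg hε0.le] at e1 e2
      rw [max_eq_left zero_le_one, mul_one] at e1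
      simp only [max_eq_right (zero_le_one (α := ℝ)), mul_one] at e2
      set p : ι → ℝ := fun k => (φ t (x + Pi.single k (W * h)) - φ t x) / (W * h) with hp
      have hpn : ‖p - grad (φ t₀) x₀‖ ≤ c := by
        refine (pi_norm_le_iff_of_nonneg hc0.le).2 fun k => ?_
        have e3 : p k - grad (φ t₀) x₀ k = (φ t (x + Pi.single k (W * h)) - φ t x -
            W * h * grad (φ t₀) x₀ k) / (W * h) := by
          simp only [hp]; field_simp
        rw [Pi.sub_apply, e3, Real.norm_eq_abs, abs_div, abs_of_pos hε0, div_le_iff₀ hε0]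
        exact e2 k
      have hHp := (abs_le.1 (hlip p (grad (φ t₀) x₀))).2
      have hHp2 := mul_le_mul_of_nonneg_left hpn hW.le
      have hcW : c + W * c = γ / 2 := by
        rw [hc]; field_simp
      have hH3 : H p ≤ H (grad (φ t₀) x₀) + W * c := by linarith
      have hH4 := mul_le_mul_of_nonneg_left hH3 hh0.le
      have e4 := (abs_le.1 e1).1
      have e5 : h * (γ / 2) = h * c + h * (W * c) := by rw [← hcW]; ring
      have e6 : h * γ = h * deriv (fun s => φ s x₀) t₀ - h * H (grad (φ t₀) x₀) := by
        rw [hγdef]; ring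
      show φ t x + h * H p + h * (γ / 2) ≤ _
      linarith
    have hinit : ∀ x ∈ B 0, upwindApprox H W ψ (i + m) (t₀ - s) x ≤
        φ (t₀ - s + (0 : ℕ) * h) x + (f t₀ x₀ - φ t₀ x₀ + s * γ / 4) := by
      rintro x ⟨h1, h2⟩
      simp only [Nat.cast_zero, zero_mul, sub_zero] at h2
      have h3 := hj x ⟨h1, h2⟩
      have h4 := (hball₁ _ ((hnear (t₀ - s) x le_rfl (by linarith) h1 h2).trans_le
        (min_le_left _ _))).2
      simp only [Nat.cast_zero, zero_mul, add_zero]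
      linarith
    have hfinal := upwindStep_iterate_le (v := fun l => φ (t₀ - s + (l : ℕ) * h)) hmono hlip
      hW.le hh0.le hε0 (by rw [mul_comm]) hB hv hinit le_rfl x₀ ⟨le_rfl, fun k => by rw [hnh]; simp⟩
    rw [upwindApprox, ← Function.iterate_add_apply, ← hfloor] at hfinal
    simp only [hnh, sub_add_cancel] at hfinal
    have e7 : (n : ℝ) * (h * (γ / 2)) = s * γ / 2 := by rw [← mul_assoc, hnh]; ring
    rw [upwindApprox]
    linarith
  have := le_of_tendsto (hf t₀ (Ioi_subset_Ici_self ht₀) x₀ (openOrthant_subset hx₀)) hkey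
  have : 0 < s * γ / 4 := by positivity
  linarith

theorem IsUpwindLimit.superTest (hf : IsUpwindLimit H W ψ f)
    (hmono : ∀ y y', y ≤ y' → H y ≤ H y')
    (hlip : ∀ y y', |H y - H y'| ≤ W * ‖y - y'‖) (hW : 0 < W) {L : ℝ} (hL : 0 ≤ L)
    (hψ : ∀ z, IncrementLE ψ z (L * ∑ k, |z k|)) : SuperTest H f := by
  refine SubTest.neg_superTest (hf.reflect.subTest (L := L) (fun y y' hyy' =>
    neg_le_neg (hmono _ _ (neg_le_neg hyy'))) (fun y y' => ?_) hW hL fun z x hx hxz => ?_)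
  · have h1 := hlip (-y') (-y)
    rw [ProjHJ.reflect, ProjHJ.reflect, neg_sub_neg]
    rwa [neg_sub_neg] at h1
  · have h1 := hψ (-z) (x + z) hxz (by simpa using hx)
    simp only [Pi.neg_apply, abs_neg, add_neg_cancel_right] at h1 ⊢
    linarith

end Existence

/-! ### Lipschitz constants -/

section Lipschitz

variable {ι : Type*} [Fintype ι]

theorem lipL1_le_ofReal [Nonempty ι] {h : (ι → ℝ) → ℝ} {M : ℝ}
    (hM : ∀ x ∈ orthant ι, ∀ y ∈ orthant ι, |h x - h y| ≤ M * normL1 (x - y)) :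
    lipL1 h ≤ ENNReal.ofReal M := by
  refine iSup₂_le fun x hx => iSup₂_le fun y hy => iSup_le fun hxy => ?_
  refine ENNReal.ofReal_le_ofReal ?_
  rw [div_le_iff₀ (normL1_pos (sub_ne_zero.2 hxy))]
  exact hM x hx y hy

theorem ofReal_le_lipL1 (h : (ι → ℝ) → ℝ) {x y : ι → ℝ} (hx : x ∈ orthant ι) (hy : y ∈ orthant ι)
    (hxy : x ≠ y) : ENNReal.ofReal (|h x - h y| / normL1 (x - y)) ≤ lipL1 h :=
  le_iSup₂_of_le x hx (le_iSup₂_of_le y hy (le_iSup_of_le hxy le_rfl))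

theorem abs_sub_le_lipL1_mul [Nonempty ι] {h : (ι → ℝ) → ℝ} (hh : lipL1 h ≠ ⊤) {x y : ι → ℝ}
    (hx : x ∈ orthant ι) (hy : y ∈ orthant ι) : |h x - h y| ≤ (lipL1 h).toReal * normL1 (x - y) := by
  rcases eq_or_ne x y with rfl | hxy
  · simpa using mul_nonneg ENNReal.toReal_nonneg (normL1_nonneg _)
  · have h1 := (ENNReal.ofReal_le_iff_le_toReal hh).1 (ofReal_le_lipL1 h hx hy hxy)
    rwa [div_le_iff₀ (normL1_pos (sub_ne_zero.2 hxy))] at h1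

omit [Fintype ι] in
theorem abs_sub_le_timeGrowth_mul {u : ℝ → (ι → ℝ) → ℝ} (hu : timeGrowth u ≠ ⊤) {t : ℝ}
    (ht : 0 ≤ t) {x : ι → ℝ} (hx : x ∈ orthant ι) :
    |u t x - u 0 x| ≤ (timeGrowth u).toReal * t := by
  rcases ht.eq_or_lt with rfl | ht
  · simp
  · have h1 : ENNReal.ofReal (|u t x - u 0 x| / t) ≤ timeGrowth u :=
      le_iSup₂_of_le t ht (le_iSup₂_of_le x hx le_rfl)
    have h2 := (ENNReal.ofReal_le_iff_le_toReal hu).1 h1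
    rwa [div_le_iff₀ ht] at h2

theorem MemLUnif.lipL1_ne_top {u : ℝ → (ι → ℝ) → ℝ} (hu : MemLUnif u) {t : ℝ} (ht : 0 ≤ t) :
    lipL1 (u t) ≠ ⊤ :=
  ((le_iSup₂_of_le (f := fun t (_ : t ∈ Ici (0 : ℝ)) => lipL1 (u t)) t ht le_rfl).trans_lt
    hu.2).ne

theorem forall_incrementLE_iff {h : (ι → ℝ) → ℝ} {M : ℝ} :
    (∀ z, IncrementLE h z (M * normL1 z)) ↔
      ∀ x ∈ orthant ι, ∀ y ∈ orthant ι, |h x - h y| ≤ M * normL1 (x - y) := by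
  constructor
  · intro hinc x hx y hy
    have h1 := hinc (x - y) y hy (by simpa using hx)
    have h2 := hinc (y - x) x hx (by simpa using hy)
    rw [normL1_sub_comm y x] at h2
    rw [add_sub_cancel] at h1 h2
    exact abs_le.2 ⟨by linarith, by linarith⟩
  · intro hM z x hx hxz
    have h1 := (abs_le.1 (hM _ hxz x hx)).2
    rw [add_sub_cancel_left] at h1
    linarith

theorem normL1_le_norm [Nonempty ι] (x : ι → ℝ) : normL1 x ≤ ‖x‖ := by
  have hd := card_pos_real (ι := ι)
  refine le_of_mul_le_mul_left ?_ hd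
  rw [card_mul_normL1]
  refine (Finset.sum_le_card_nsmul _ _ ‖x‖ fun k _ => norm_le_pi_norm x k).trans (le_of_eq ?_)
  rw [nsmul_eq_mul, Finset.card_univ]

theorem lipschitzOnWith_orthant [Nonempty ι] {h : (ι → ℝ) → ℝ} {M : ℝ} (hM0 : 0 ≤ M)
    (hM : ∀ x ∈ orthant ι, ∀ y ∈ orthant ι, |h x - h y| ≤ M * normL1 (x - y)) :
    LipschitzOnWith M.toNNReal h (orthant ι) := by
  refine LipschitzOnWith.of_dist_le_mul fun x hx y hy => ?_
  rw [Real.dist_eq, dist_eq_norm, Real.coe_toNNReal _ hM0]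
  exact (hM x hx y hy).trans (mul_le_mul_of_nonneg_left (normL1_le_norm _) hM0)

end Lipschitz

/-! ### Well-posedness of the equation -/

section WellPosed

variable {ι : Type*} [Fintype ι] [DecidableEq ι] [Nonempty ι] {H : (ι → ℝ) → ℝ} {W : ℝ}
  {ψ : (ι → ℝ) → ℝ}

/-- The linear growth in time and the Lipschitz initial condition provide the bound required by
`comparison`. -/
theorem IsSolutionFrom.le (hmono : ∀ y y', y ≤ y' → H y ≤ H y') (hW : 0 ≤ W)
    (hlip : ∀ y y', |H y - H y'| ≤ W * ‖y - y'‖) {f f' : ℝ → (ι → ℝ) → ℝ}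
    (hf : IsSolutionFrom H ψ f) (hf' : IsSolutionFrom H ψ f') {t : ℝ} (ht : 0 ≤ t) {x : ι → ℝ}
    (hx : x ∈ openOrthant ι) : f t x ≤ f' t x := by
  obtain ⟨⟨hc, hsub, -⟩, hm, h0⟩ := hf
  obtain ⟨⟨hc', -, hsup⟩, hm', h0'⟩ := hf'
  set C := max (timeGrowth f).toReal (timeGrowth f').toReal
  set L := (lipL1 (f 0)).toReal * (1 / (Fintype.card ι : ℝ))
  have hsup' : SuperTest H f' := hsup.2
  have key := comparison hmono hW hlip (u := f) (w := fun t x => -f' t x) hsub.2 hsup'.neg hc hc'.neg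
    (L := L) (C := C) (by
      rintro p ⟨hp1, hp2⟩ q ⟨hq1, hq2⟩
      have hp1 : 0 ≤ p.1 := hp1
      have hq1 : 0 ≤ q.1 := hq1
      have hpo := openOrthant_subset hp2
      have hqo := openOrthant_subset hq2
      have e1 := (abs_le.1 (abs_sub_le_timeGrowth_mul hm.1.2.ne hp1 hpo)).2
      have e2 := (abs_le.1 (abs_sub_le_timeGrowth_mul hm'.1.2.ne hq1 hqo)).1
      have e3 := (abs_le.1 (abs_sub_le_lipL1_mul hm.1.1.ne hpo hqo)).2
      have e4 := mul_le_mul_of_nonneg_right (le_max_left _ _ : (timeGrowth f).toReal ≤ C) hp1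
      have e5 := mul_le_mul_of_nonneg_right (le_max_right _ _ : (timeGrowth f').toReal ≤ C) hq1
      have e6 : L * ∑ k, |p.2 k - q.2 k| = (lipL1 (f 0)).toReal * normL1 (p.2 - q.2) := by
        simp only [L, normL1, Pi.sub_apply, mul_assoc]
      have e7 : f 0 q.2 = f' 0 q.2 := by rw [h0 _ hqo, h0' _ hqo]
      rw [e6]
      linarith) (t, x) ⟨ht, hx⟩
  simp only at key
  linarith

theorem IsSolutionFrom.unique (hmono : ∀ y y', y ≤ y' → H y ≤ H y') (hW : 0 ≤ W)
    (hlip : ∀ y y', |H y - H y'| ≤ W * ‖y - y'‖) {f f' : ℝ → (ι → ℝ) → ℝ}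
    (hf : IsSolutionFrom H ψ f) (hf' : IsSolutionFrom H ψ f') {t : ℝ} (ht : 0 ≤ t) {x : ι → ℝ}
    (hx : x ∈ orthant ι) : f t x = f' t x := by
  have hL := fun (y : ι → ℝ) (hy : y ∈ orthant ι) =>
    abs_sub_le_lipL1_mul (hf.2.1.lipL1_ne_top ht) hx hy
  have hL' := fun (y : ι → ℝ) (hy : y ∈ orthant ι) =>
    abs_sub_le_lipL1_mul (hf'.2.1.lipL1_ne_top ht) hy hx
  set L := (lipL1 (f t)).toReal
  set L' := (lipL1 (f' t)).toReal
  -- the solutions agree in the open orthant; shift `x` inside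
  have key : ∀ δ > 0, |f t x - f' t x| ≤ (L + L') * δ := by
    intro δ hδ
    set y : ι → ℝ := x + fun _ => δ
    have hy : y ∈ openOrthant ι := fun k => add_pos_of_nonneg_of_pos (hx k) hδ
    have hyo := openOrthant_subset hy
    have e1 : f t y = f' t y := le_antisymm (hf.le hmono hW hlip hf' ht hy)
      (hf'.le hmono hW hlip hf ht hy)
    have e2 : normL1 (y - x) = δ := by
      simp [y, normL1, abs_of_pos hδ]
    have e3 := hL y hyo
    have e4 := hL' y hyo
    rw [normL1_sub_comm, e2] at e3
    rw [e2] at e4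
    calc |f t x - f' t x| = |(f t x - f t y) + (f' t y - f' t x)| := by rw [e1]; ring_nf
      _ ≤ _ := abs_add_le _ _
      _ ≤ _ := by linarith
  have hlim : Tendsto (fun δ : ℝ => (L + L') * δ) (𝓝[>] 0) (𝓝 0) := by
    have : Continuous fun δ : ℝ => (L + L') * δ := by fun_prop
    have := (this.tendsto 0).mono_left (nhdsWithin_le_nhds (s := Ioi 0))
    simpa using this
  have h1 := ge_of_tendsto hlim (eventually_of_mem self_mem_nhdsWithin key)
  exact sub_eq_zero.1 (abs_eq_zero.1 (le_antisymm h1 (abs_nonneg _)))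

/-- The solution inherits from its initial condition every bound on increments, hence every closed
convex constraint on the gradient. -/
theorem exists_isSolutionFrom (hmono : ∀ y y', y ≤ y' → H y ≤ H y') (hW : 0 < W)
    (hlip : ∀ y y', |H y - H y'| ≤ W * ‖y - y'‖) (hψ : lipL1 ψ ≠ ⊤) :
    ∃ f, IsSolutionFrom H ψ f ∧ supLipL1 f = lipL1 ψ ∧
      ∀ 𝒦 : Set (ι → ℝ), Convex ℝ 𝒦 → IsClosed 𝒦 → HasGradientIn ψ 𝒦 →
        ∀ t ∈ Ici (0 : ℝ), HasGradientIn (f t) 𝒦 := by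
  set M := (lipL1 ψ).toReal with hM
  have hM0 : 0 ≤ M := ENNReal.toReal_nonneg
  have hψM : ∀ x ∈ orthant ι, ∀ y ∈ orthant ι, |ψ x - ψ y| ≤ M * normL1 (x - y) :=
    fun x hx y hy => abs_sub_le_lipL1_mul hψ hx hy
  set L := M * (1 / (Fintype.card ι : ℝ)) with hLdef
  have hL : 0 ≤ L := by positivity
  have hψL : ∀ z, IncrementLE ψ z (L * ∑ k, |z k|) := by
    intro z
    rw [hLdef, mul_assoc]
    exact forall_incrementLE_iff.2 hψM z
  obtain ⟨f, hf⟩ := exists_isUpwindLimit hmono hlip hW hL hψL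
  have hinit : ∀ x ∈ orthant ι, f 0 x = ψ x := fun x hx => hf.initial hx
  have hfM : ∀ t, 0 ≤ t → ∀ x ∈ orthant ι, ∀ y ∈ orthant ι,
      |f t x - f t y| ≤ M * normL1 (x - y) := fun t ht =>
    forall_incrementLE_iff.1 fun z =>
      hf.incrementLE hmono hlip hW (forall_incrementLE_iff.2 hψM z) ht
  set T := |H 0| + W * L
  have hT : 0 ≤ T := by positivity
  have htime : ∀ s t, 0 ≤ s → 0 ≤ t → ∀ x ∈ orthant ι, |f t x - f s x| ≤ |t - s| * T :=
    fun s t hs ht x hx => hf.abs_sub_le hmono hlip hW hL hψL hs ht hx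
  have hlipf : ∀ t, 0 ≤ t → lipL1 (f t) ≤ lipL1 ψ := fun t ht =>
    (lipL1_le_ofReal (hfM t ht)).trans (ENNReal.ofReal_toReal hψ).le
  have hcont : ContinuousOn (fun p : ℝ × (ι → ℝ) => f p.1 p.2) (Ici 0 ×ˢ openOrthant ι) := by
    refine (LipschitzOnWith.of_dist_le_mul (K := (T + M).toNNReal) ?_).continuousOn
    rintro p ⟨hp1, hp2⟩ q ⟨hq1, hq2⟩
    have hpo := openOrthant_subset hp2
    have hqo := openOrthant_subset hq2
    have e1 := htime q.1 p.1 hq1 hp1 p.2 hpo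
    have e2 := hfM q.1 hq1 p.2 hpo q.2 hqo
    have e3 : |p.1 - q.1| * T ≤ T * dist p q := by
      rw [mul_comm]
      exact mul_le_mul_of_nonneg_left (le_max_left _ _) hT
    have e4 : M * normL1 (p.2 - q.2) ≤ M * dist p q := by
      refine mul_le_mul_of_nonneg_left ((normL1_le_norm _).trans ?_) hM0
      rw [← dist_eq_norm]
      exact le_max_right _ _
    rw [Real.dist_eq, Real.coe_toNNReal _ (by positivity), add_mul]
    calc |f p.1 p.2 - f q.1 q.2| = |(f p.1 p.2 - f q.1 p.2) + (f q.1 p.2 - f q.1 q.2)| := by ring_nf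
      _ ≤ _ := abs_add_le _ _
      _ ≤ _ := by linarith
  refine ⟨f, ⟨⟨hcont, ⟨hcont.upperSemicontinuousOn, hf.subTest hmono hlip hW hL hψL⟩,
    ⟨hcont.lowerSemicontinuousOn, hf.superTest hmono hlip hW hL hψL⟩⟩, ⟨⟨?_, ?_⟩, ?_⟩, hinit⟩,
    le_antisymm ?_ ?_, ?_⟩
  · exact (hlipf 0 le_rfl).trans_lt hψ.lt_top
  · refine lt_of_le_of_lt (iSup₂_le fun t ht => iSup₂_le fun x hx => ?_)
      (ENNReal.ofReal_lt_top (r := T))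
    have ht : 0 < t := ht
    refine ENNReal.ofReal_le_ofReal ?_
    rw [div_le_iff₀ ht, mul_comm]
    simpa [abs_of_pos ht] using htime 0 t le_rfl ht.le x hx
  · exact lt_of_le_of_lt (iSup₂_le fun t ht => hlipf t ht) hψ.lt_top
  · exact iSup₂_le fun t ht => hlipf t (Ioi_subset_Ici_self ht)
  · -- let `t` tend to `0`
    refine iSup₂_le fun x hx => iSup₂_le fun y hy => iSup_le fun hxy => ?_
    have hlim : ∀ x ∈ orthant ι, Tendsto (fun t => f t x) (𝓝[>] 0) (𝓝 (ψ x)) := by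
      intro x hx
      rw [← hinit x hx, tendsto_iff_dist_tendsto_zero]
      have h1 : Tendsto (fun t : ℝ => |t - 0| * T) (𝓝[>] 0) (𝓝 0) := by
        have : Continuous fun t : ℝ => |t - 0| * T := by fun_prop
        have := (this.tendsto 0).mono_left (nhdsWithin_le_nhds (s := Ioi 0))
        simpa using this
      refine squeeze_zero' (Eventually.of_forall fun _ => dist_nonneg) ?_ h1
      filter_upwards [self_mem_nhdsWithin] with t ht
      exact htime 0 t le_rfl (Ioi_subset_Ici_self ht) x hx
    refine le_of_tendsto (ENNReal.tendsto_ofReal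
      (((hlim x hx).sub (hlim y hy)).abs.div_const (normL1 (x - y)))) ?_
    filter_upwards [self_mem_nhdsWithin] with t ht
    exact (ofReal_le_lipL1 (f t) hx hy hxy).trans (le_iSup₂_of_le t ht le_rfl)
  · intro 𝒦 hconv hclosed hgrad t ht
    refine hasGradientIn_of_incrementLE (lipschitzOnWith_orthant hM0 (hfM t ht)) hconv hclosed
      fun z c hz => hf.incrementLE hmono hlip hW ?_ ht
    exact hgrad.incrementLE (lipschitzOnWith_orthant hM0 hψM) hz

end WellPosed

/-! ### The dyadic projections -/

section Dyadic

variable {K : ℕ}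

instance : Nonempty (DyadicIdx K) := ⟨⟨0, by simp⟩⟩

theorem dyadicMeasure_apply {x : DyadicIdx K → ℝ} (hx : x ∈ orthant (DyadicIdx K))
    (A : Set (Icc (-1 : ℝ) 1)) : ((dyadicMeasure x A : ℝ≥0) : ℝ) =
      (1 / (Fintype.card (DyadicIdx K) : ℝ)) * ∑ k, x k * (diracFM (dyadicPoint k) A : ℝ≥0) := by
  have h1 : ((∑ k, (x k).toNNReal • diracFM (dyadicPoint k) :
      FiniteMeasure (Icc (-1 : ℝ) 1)) A) = ∑ k, (x k).toNNReal * diracFM (dyadicPoint k) A := by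
    generalize (Finset.univ : Finset (DyadicIdx K)) = s
    induction s using Finset.induction_on with
    | empty => simp
    | insert k s hk ih =>
      rw [Finset.sum_insert hk, Finset.sum_insert hk, FiniteMeasure.coeFn_add, Pi.add_apply, ih,
        FiniteMeasure.smul_apply, smul_eq_mul]
  rw [dyadicMeasure, FiniteMeasure.smul_apply, h1]
  simp only [smul_eq_mul, NNReal.coe_mul, NNReal.coe_sum, NNReal.coe_inv, NNReal.coe_natCast,
    one_div]
  congr 1
  exact Finset.sum_congr rfl fun k _ => by rw [Real.coe_toNNReal _ (hx k)]

theorem diracFM_apply_le_one (p : Icc (-1 : ℝ) 1) (A : Set (Icc (-1 : ℝ) 1)) :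
    diracFM p A ≤ 1 := by
  refine (FiniteMeasure.apply_le_mass _ _).trans (le_of_eq ?_)
  simp [diracFM, FiniteMeasure.mass]

theorem abs_dyadicMeasure_sub_le {x y : DyadicIdx K → ℝ} (hx : x ∈ orthant (DyadicIdx K))
    (hy : y ∈ orthant (DyadicIdx K)) (A : Set (Icc (-1 : ℝ) 1)) :
    |((dyadicMeasure x A : ℝ≥0) : ℝ) - ((dyadicMeasure y A : ℝ≥0) : ℝ)| ≤ normL1 (x - y) := by
  rw [dyadicMeasure_apply hx, dyadicMeasure_apply hy, ← mul_sub, ← Finset.sum_sub_distrib, abs_mul,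
    abs_of_nonneg (by positivity), normL1]
  refine mul_le_mul_of_nonneg_left ((Finset.abs_sum_le_sum_abs _ _).trans
    (Finset.sum_le_sum fun k _ => ?_)) (by positivity)
  rw [← sub_mul, abs_mul, Pi.sub_apply, NNReal.abs_eq]
  exact mul_le_of_le_one_right (abs_nonneg _) (by exact_mod_cast diracFM_apply_le_one _ _)

theorem tv_dyadicMeasure_le {x y : DyadicIdx K → ℝ} (hx : x ∈ orthant (DyadicIdx K))
    (hy : y ∈ orthant (DyadicIdx K)) :
    tv (dyadicMeasure x) (dyadicMeasure y) ≤ normL1 (x - y) := by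
  have : Nonempty {A : Set (Icc (-1 : ℝ) 1) // MeasurableSet A} := ⟨⟨∅, MeasurableSet.empty⟩⟩
  exact ciSup_le fun A => abs_dyadicMeasure_sub_le hx hy A.1

theorem tv_nonneg (μ ν : FiniteMeasure (Icc (-1 : ℝ) 1)) : 0 ≤ tv μ ν :=
  Real.iSup_nonneg fun _ => abs_nonneg _

variable {ψ : FiniteMeasure (Icc (-1 : ℝ) 1) → ℝ} {C : ℝ}

theorem abs_projInit_sub_le (hψ : ∀ μ ν, |ψ μ - ψ ν| ≤ C * tv μ ν) {x y : DyadicIdx K → ℝ}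
    (hx : x ∈ orthant (DyadicIdx K)) (hy : y ∈ orthant (DyadicIdx K)) :
    |projInit ψ K x - projInit ψ K y| ≤ |C| * normL1 (x - y) := by
  refine (hψ _ _).trans ?_
  calc C * tv (dyadicMeasure x) (dyadicMeasure y)
      ≤ |C| * tv (dyadicMeasure x) (dyadicMeasure y) :=
        mul_le_mul_of_nonneg_right (le_abs_self C) (tv_nonneg _ _)
    _ ≤ _ := mul_le_mul_of_nonneg_left (tv_dyadicMeasure_le hx hy) (abs_nonneg C)

theorem lipL1_projInit_ne_top (hψ : ∀ μ ν, |ψ μ - ψ ν| ≤ C * tv μ ν) :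
    lipL1 (projInit ψ K) ≠ ⊤ :=
  ((lipL1_le_ofReal fun _ hx _ hy => abs_projInit_sub_le hψ hx hy).trans_lt
    ENNReal.ofReal_lt_top).ne

theorem lipL1_projInit_le (hψ : ∀ μ ν, |ψ μ - ψ ν| ≤ C * tv μ ν) :
    lipL1 (projInit ψ K) ≤ lipTV ψ := by
  refine iSup₂_le fun x hx => iSup₂_le fun y hy => iSup_le fun hxy => ?_
  rcases (tv_nonneg (dyadicMeasure x) (dyadicMeasure y)).eq_or_lt with h0 | hpos
  · -- the total variation distance vanishes, hence so does the increment of `ψ`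
    have h1 := hψ (dyadicMeasure x) (dyadicMeasure y)
    rw [← h0, mul_zero] at h1
    have h2 : |projInit ψ K x - projInit ψ K y| = 0 := le_antisymm h1 (abs_nonneg _)
    simp [h2]
  · have hne : dyadicMeasure x ≠ dyadicMeasure y := by
      intro h
      rw [h] at hpos
      simp [tv] at hpos
    refine le_trans (ENNReal.ofReal_le_ofReal ?_)
      (le_iSup₂_of_le (dyadicMeasure x) (dyadicMeasure y) (le_iSup_of_le hne le_rfl))
    exact div_le_div_of_nonneg_left (abs_nonneg _) hpos (tv_dyadicMeasure_le hx hy)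

theorem kernelMatrix_isSymm (g : ℝ → ℝ) (K : ℕ) : (kernelMatrix g K).IsSymm := by
  ext k k'
  simp only [Matrix.transpose_apply, kernelMatrix, mul_comm]

theorem div_le_kernelMatrix {g : ℝ → ℝ} {m : ℝ} (hgm : ∀ x ∈ Icc (-1 : ℝ) 1, m ≤ g x)
    (k k' : DyadicIdx K) :
    m / (Fintype.card (DyadicIdx K) : ℝ) ^ 2 ≤ kernelMatrix g K k k' := by
  rw [kernelMatrix, div_eq_mul_one_div, mul_comm]
  refine mul_le_mul_of_nonneg_left (hgm _ ?_) (by positivity)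
  have h1 := abs_le.2 (dyadicPoint k).2
  have h2 := abs_le.2 (dyadicPoint k').2
  rw [mem_Icc, ← abs_le, abs_mul]
  exact mul_le_one₀ h1 (abs_nonneg _) h2

end Dyadic

end ProjHJ

theorem theorem1p1
    (g : ℝ → ℝ) (hg : ContDiffOn ℝ 1 g (Icc (-1) 1))
    (m : ℝ) (hm : 0 < m) (hgm : ∀ x ∈ Icc (-1 : ℝ) 1, m ≤ g x)
    (ψ : FiniteMeasure (Icc (-1 : ℝ) 1) → ℝ)
    (hψ : ∃ C : ℝ, ∀ μ ν : FiniteMeasure (Icc (-1 : ℝ) 1), |ψ μ - ψ ν| ≤ C * tv μ ν)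
    (a : ℝ) (ha : 0 < a)
    (hgrad : ∀ K : ℕ, 1 ≤ K →
      HasGradientIn (projInit ψ K) (enlarge (coneBall (kernelMatrix g K) a)))
    (K : ℕ) (hK : 1 ≤ K) (R : ℝ) (hR : 0 < R) :
    IsAdmissibleExtension (kernelMatrix g K) R (extNonlinearity (kernelMatrix g K) m R) ∧
    ∀ H : (DyadicIdx K → ℝ) → ℝ, IsAdmissibleExtension (kernelMatrix g K) R H →
      ∃ f : ℝ → (DyadicIdx K → ℝ) → ℝ,
        IsSolutionFrom H (projInit ψ K) f ∧
        (∀ f' : ℝ → (DyadicIdx K → ℝ) → ℝ, IsSolutionFrom H (projInit ψ K) f' →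
          ∀ t ∈ Ici (0 : ℝ), ∀ x ∈ orthant (DyadicIdx K), f' t x = f t x) ∧
        (∀ t ∈ Ici (0 : ℝ),
          HasGradientIn (f t) (enlarge (coneBall (kernelMatrix g K) a))) ∧
        supLipL1 f = lipL1 (projInit ψ K) ∧
        lipL1 (projInit ψ K) ≤ lipTV ψ := by

  obtain ⟨C, hC⟩ := hψ
  refine ⟨isAdmissibleExtension_extNonlinearity (kernelMatrix_isSymm g K) hm hR
    (div_le_kernelMatrix hgm), ?_⟩
  rintro H ⟨hmono, ⟨V, hV⟩, -⟩
  set W : ℝ := |V| * Fintype.card (DyadicIdx K) + 1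
  have hW : 0 < W := by positivity
  have hlip : ∀ y y', |H y - H y'| ≤ W * ‖y - y'‖ := fun y y' => by
    refine (hV y y').trans ?_
    rw [normL1Star_eq, ← mul_assoc]
    refine mul_le_mul_of_nonneg_right ?_ (norm_nonneg _)
    have := mul_le_mul_of_nonneg_right (le_abs_self V)
      (Nat.cast_nonneg (α := ℝ) (Fintype.card (DyadicIdx K)))
    linarith
  obtain ⟨f, hf, hsup, hK𝒦⟩ := exists_isSolutionFrom hmono hW hlip (lipL1_projInit_ne_top (K := K) hC)
  exact ⟨f, hf, fun f' hf' t ht x hx => hf'.unique hmono hW.le hlip hf ht hx,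
    hK𝒦 _ (convex_enlarge_coneBall _ a) (isClosed_enlarge_coneBall _ a) (hgrad K hK), hsup,
    lipL1_projInit_le hC⟩
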